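/- Let $R$ be a small preadditive category (for example a ring with $1$, regarded as a preadditive category with one object). A left $R$-module is an additive functor $N : R\to\mathbf{Ab}$, with sorts $N(c)$, $c\in R$; right $R$-modules are left $R^{\rm op}$-modules. A pp formula is an existentially quantified finite system of $R$-linear equations $\exists \overline{y}\; G\overline{x}+H\overline{y}=0$ in sorted variables, with solution set $\phi(N)$ in a module $N$. A pp-pair $\phi/\psi$ consists of two pp formulas in the same free variables with $\psi(N)\le\phi(N)$ for every $R$-module $N$; its value at $N$ is $\phi(N)/\psi(N)$, a left $\mathrm{End}(N)$-module. For a class $\mathcal{N}$ of $R$-modules, the category of pp-pairs for $\mathcal{N}$ has the pp-pairs as objects; a morphism from $\phi/\psi$ to $\phi'/\psi'$ is a pp-definable function, that is, a family of functions $\phi(N)/\psi(N)\to\phi'(N)/\psi'(N)$, $N\in\mathcal{N}$, whose graphs are all induced by a single pp formula $\theta(\overline{x},\overline{x}')$. A class of $R$-modules is definable if it is closed under isomorphism, direct products, direct limits and pure submodules. The functor category of a definable class $\mathcal{D}$ is the quotient of the category of pp-pairs for all $R$-modules by its Serre subcategory of those pp-pairs $\phi/\psi$ with $\phi(D)/\psi(D)=0$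 for all $D\in\mathcal{D}$ (the localisation inverting the morphisms with kernel and cokernel in that subcategory). **Theorem.** Let $M$ be a finitely presented $R$-module which is noetherian over its endomorphism ring $S=\mathrm{End}(M)$, which acts on the left (i.e. every sort of $M$ is a noetherian left $S$-module; if $R$ is a ring, $M$ itself is). Let $\mathcal{D}$ be the smallest definable class of $R$-modules that contains $M$. Then each of the following categories is equivalent to the category $S\text{-mod}$ of finitely presented left $S$-modules: 1. the functor category $\mathcal{A}(M)=\mathcal{A}(\mathcal{D})$ of $\mathcal{D}$; 2. the category of pp-pairs for $\mathcal{D}$; 3. the category of pp-pairs for $\{M\}$. In each case there is an equivalence given by evaluation at $M$, $F\mapsto F(M)$, i.e. naturally in $\phi/\psi$ it sends $\phi/\psi$ to the left $S$-module $\phi(M)/\psi(M)$. In case 1 this means that the composite of the quotient functor from pp-pairs for all $R$-modules with the equivalence is naturally isomorphic to evaluation at $M$. -/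

import Mathlib

open CategoryTheory CategoryTheory.Limits

universe u v w

namespace MultisortedModule

/-! Throughout, `C` is a small preadditive category, regarded as a ring with several objects (a ring
`R` being the case of one object). A left `C`-module is an additive functor
`C ⥤ AddCommGrpCat`, i.e. an object `N : C ⥤ AddCommGrpCat` with `N.Additive`; right modules are
the left modules over `Cᵒᵖ`. The group of elements of `N` of sort `c` is `N.obj c`. -/

variable {C : Type u} [Category.{v} C]

/-- The endomorphism ring of `N` acts on the left on each sort of `N`. -/
instance endModule (N : C ⥤ AddCommGrpCat.{max u v}) (c : C) : Module (End N) (N.obj c) where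
  smul s x := (NatTrans.app (show N ⟶ N from s) c).hom x
  one_smul _ := rfl
  mul_smul _ _ _ := rfl
  smul_zero s := map_zero (NatTrans.app (show N ⟶ N from s) c).hom
  smul_add s x y := map_add (NatTrans.app (show N ⟶ N from s) c).hom x y
  add_smul _ _ _ := rfl
  zero_smul _ := rfl

theorem end_smul_def (N : C ⥤ AddCommGrpCat.{max u v}) (c : C) (s : End N) (x : N.obj c) :
    s • x = (NatTrans.app (show N ⟶ N from s) c).hom x := rfl

theorem map_end_smul (N : C ⥤ AddCommGrpCat.{max u v}) {c d : C} (f : c ⟶ d) (s : End N)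
    (x : N.obj c) : (N.map f).hom (s • x) = s • (N.map f).hom x := by
  have h := (NatTrans.naturality (show N ⟶ N from s) f)
  exact (congrArg (fun g => g.hom x) h).symm

/-- The value at the tuple `x` of the linear form `∑ i, g i (x i)`, with coefficients `g i`. -/
def lin {ι : Type} [Fintype ι] {σ : ι → C} {c : C} (g : ∀ i, σ i ⟶ c)
    (N : C ⥤ AddCommGrpCat.{max u v}) (x : ∀ i, N.obj (σ i)) : N.obj c :=
  ∑ i, (N.map (g i)).hom (x i)

/-- The tuple `(x, x')`. -/
def pairTuple {ι κ : Type} {σ : ι → C} {σ' : κ → C} {N : C ⥤ AddCommGrpCat.{max u v}}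
    (x : ∀ i, N.obj (σ i)) (y : ∀ i, N.obj (σ' i)) : ∀ i : ι ⊕ κ, N.obj (Sum.elim σ σ' i)
  | Sum.inl i => x i
  | Sum.inr i => y i

theorem exists_tuple_sum {ι κ : Type} {σ : ι → C} {σ' : κ → C} {N : C ⥤ AddCommGrpCat.{max u v}}
    {p : (∀ i, N.obj (Sum.elim σ σ' i)) → Prop} :
    (∃ t, p t) ↔ ∃ (x : ∀ i, N.obj (σ i)) (y : ∀ i, N.obj (σ' i)), p (pairTuple x y) := by
  constructor
  · rintro ⟨t, ht⟩
    refine ⟨fun i => t (Sum.inl i), fun i => t (Sum.inr i), ?_⟩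
    have e : pairTuple (fun i => t (Sum.inl i)) (fun i => t (Sum.inr i)) = t := by
      funext i
      rcases i with i | i <;> rfl
    exact (congrArg p e).mpr ht
  · rintro ⟨x, y, h⟩
    exact ⟨_, h⟩

section lin

variable {ι κ : Type} [Fintype ι] [Fintype κ] {σ : ι → C} {c : C}

theorem lin_tuple_zero (g : ∀ i, σ i ⟶ c) (N : C ⥤ AddCommGrpCat.{max u v}) : lin g N 0 = 0 := by
  simp [lin]

theorem lin_tuple_add (g : ∀ i, σ i ⟶ c) (N : C ⥤ AddCommGrpCat.{max u v})
    (x y : ∀ i, N.obj (σ i)) : lin g N (x + y) = lin g N x + lin g N y := by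
  simp [lin, Finset.sum_add_distrib]

theorem lin_tuple_smul (g : ∀ i, σ i ⟶ c) (N : C ⥤ AddCommGrpCat.{max u v})
    (s : End N) (x : ∀ i, N.obj (σ i)) : lin g N (s • x) = s • lin g N x := by
  simp only [lin, Pi.smul_apply, map_end_smul, Finset.smul_sum]

theorem lin_pairTuple {σ : ι → C} {σ' : κ → C} (g : ∀ i, Sum.elim σ σ' i ⟶ c)
    (N : C ⥤ AddCommGrpCat.{max u v}) (x : ∀ i, N.obj (σ i)) (y : ∀ i, N.obj (σ' i)) :
    lin g N (pairTuple x y) =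
      lin (σ := σ) (fun i => g (Sum.inl i)) N x + lin (σ := σ') (fun i => g (Sum.inr i)) N y :=
  Fintype.sum_sum_type _

theorem lin_equiv (e : κ ≃ ι) (g : ∀ i, σ i ⟶ c) (N : C ⥤ AddCommGrpCat.{max u v})
    (x : ∀ i, N.obj (σ i)) : lin (fun j => g (e j)) N (fun j => x (e j)) = lin g N x :=
  e.sum_comp (fun i => (N.map (g i)).hom (x i))

theorem lin_empty [IsEmpty ι] (g : ∀ i, σ i ⟶ c) (N : C ⥤ AddCommGrpCat.{max u v})
    (x : ∀ i, N.obj (σ i)) : lin g N x = 0 :=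
  Finset.sum_of_isEmpty _

end lin

/-! ### Positive primitive formulas -/

/-- A pp formula in the free variables `x i` of sort `σ i`, `i : ι`: the existentially quantified
system of linear equations `∃ y, ∀ r, ∑ i, G r i (x i) + ∑ j, H r j (y j) = 0`, where `y j` has
sort `τ j` (`j < m`) and the `r`-th equation (`r < k`) takes place in sort `ρ r`. -/
structure PPFormula {ι : Type} (σ : ι → C) where
  m : ℕ
  k : ℕ
  τ : Fin m → C
  ρ : Fin k → C
  G : ∀ (r : Fin k) (i : ι), σ i ⟶ ρ r
  H : ∀ (r : Fin k) (j : Fin m), τ j ⟶ ρ r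

/-- The solution set `φ(N)`; it is a subgroup of the group of tuples of the appropriate sorts, and
it is stable under the diagonal action of `End N`. -/
def PPFormula.sol {ι : Type} [Fintype ι] {σ : ι → C} (φ : PPFormula σ)
    (N : C ⥤ AddCommGrpCat.{max u v}) : Submodule (End N) (∀ i, N.obj (σ i)) where
  carrier := {x | ∃ y : ∀ j, N.obj (φ.τ j), ∀ r, lin (φ.G r) N x + lin (φ.H r) N y = 0}
  zero_mem' := ⟨0, fun r => by rw [lin_tuple_zero, lin_tuple_zero, add_zero]⟩
  add_mem' := by
    rintro a b ⟨y, hy⟩ ⟨z, hz⟩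
    refine ⟨y + z, fun r => ?_⟩
    rw [lin_tuple_add, lin_tuple_add, add_add_add_comm, hy r, hz r, add_zero]
  smul_mem' := by
    rintro s a ⟨y, hy⟩
    refine ⟨s • y, fun r => ?_⟩
    rw [lin_tuple_smul, lin_tuple_smul, ← smul_add, hy r, smul_zero]

theorem PPFormula.mem_sol {ι : Type} [Fintype ι] {σ : ι → C} {φ : PPFormula σ}
    {N : C ⥤ AddCommGrpCat.{max u v}} {x : ∀ i, N.obj (σ i)} :
    x ∈ φ.sol N ↔ ∃ y : ∀ j, N.obj (φ.τ j), ∀ r, lin (φ.G r) N x + lin (φ.H r) N y = 0 :=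
  Iff.rfl

/-- The pp formula given by a system of equations indexed by arbitrary finite types. -/
noncomputable def PPFormula.ofFintype {ι : Type} {σ : ι → C} (E K : Type) [Fintype E] [Fintype K]
    (τ : E → C) (ρ : K → C) (G : ∀ r i, σ i ⟶ ρ r) (H : ∀ r j, τ j ⟶ ρ r) : PPFormula σ where
  m := Fintype.card E
  k := Fintype.card K
  τ j := τ ((Fintype.equivFin E).symm j)
  ρ r := ρ ((Fintype.equivFin K).symm r)
  G r i := G ((Fintype.equivFin K).symm r) i
  H r j := H ((Fintype.equivFin K).symm r) ((Fintype.equivFin E).symm j)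

theorem PPFormula.mem_sol_ofFintype {ι : Type} [Fintype ι] {σ : ι → C} (E K : Type) [Fintype E]
    [Fintype K] (τ : E → C) (ρ : K → C) (G : ∀ r i, σ i ⟶ ρ r) (H : ∀ r j, τ j ⟶ ρ r)
    (N : C ⥤ AddCommGrpCat.{max u v}) (x : ∀ i, N.obj (σ i)) :
    x ∈ (PPFormula.ofFintype E K τ ρ G H).sol N ↔ ∃ y : ∀ j, N.obj (τ j), ∀ r,
      lin (G r) N x + lin (H r) N y = 0 := by
  have key : ∀ (y : ∀ j, N.obj (τ j)) (r : K),
      lin (fun j => H r ((Fintype.equivFin E).symm j)) N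
        (fun j => y ((Fintype.equivFin E).symm j)) = lin (H r) N y :=
    fun y r => lin_equiv (Fintype.equivFin E).symm (H r) N y
  constructor
  · rintro ⟨y, hy⟩
    obtain ⟨z, rfl⟩ : ∃ z : ∀ j, N.obj (τ j), (fun j => z ((Fintype.equivFin E).symm j)) = y :=
      ⟨(Fintype.equivFin E).symm.piCongrLeft (fun j => N.obj (τ j)) y,
        funext fun j => Equiv.piCongrLeft_apply_apply (fun j => N.obj (τ j)) _ y j⟩
    refine ⟨z, fun r => ?_⟩
    obtain ⟨r, rfl⟩ := (Fintype.equivFin K).symm.surjective r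
    rw [← key]
    exact hy r
  · rintro ⟨y, hy⟩
    refine ⟨fun j => y ((Fintype.equivFin E).symm j), fun r => ?_⟩
    have h := hy ((Fintype.equivFin K).symm r)
    rw [← key] at h
    exact h

variable [Preadditive C]

variable (C) in
/-- A pp-pair `φ/ψ`: two pp formulas in the same free variables such that `ψ(N) ≤ φ(N)` for every
`C`-module `N`. -/
structure PPPair where
  n : ℕ
  σ : Fin n → C
  φ : PPFormula σ
  ψ : PPFormula σ
  le : ∀ N : C ⥤ AddCommGrpCat.{max u v}, N.Additive → ψ.sol N ≤ φ.sol N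

/-- The value `φ(N)/ψ(N)` of the pp-pair `φ/ψ` at `N`, a left module over `End N`. -/
abbrev PPPair.val (P : PPPair C) (N : C ⥤ AddCommGrpCat.{max u v}) : Type (max u v) :=
  ↥(P.φ.sol N) ⧸ (P.ψ.sol N).submoduleOf (P.φ.sol N)

theorem PPPair.mk_eq_zero {P : PPPair C} {N : C ⥤ AddCommGrpCat.{max u v}} (x : P.φ.sol N) :
    (Submodule.Quotient.mk x : P.val N) = 0 ↔ x.1 ∈ P.ψ.sol N :=
  Submodule.Quotient.mk_eq_zero _

theorem PPPair.mk_eq_mk {P : PPPair C} {N : C ⥤ AddCommGrpCat.{max u v}} (x y : P.φ.sol N) :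
    (Submodule.Quotient.mk x : P.val N) = Submodule.Quotient.mk y ↔ x.1 - y.1 ∈ P.ψ.sol N :=
  Submodule.Quotient.eq _

/-- The relation from `φ(N)/ψ(N)` to `φ'(N)/ψ'(N)` induced by a formula `θ(x, x')`: the set of pairs
`(x + ψ(N), x' + ψ'(N))` with `x ∈ φ(N)`, `x' ∈ φ'(N)` and `θ(x, x')`. -/
def PPFormula.rel {P Q : PPPair C} (θ : PPFormula (Sum.elim P.σ Q.σ))
    (N : C ⥤ AddCommGrpCat.{max u v}) (a : P.val N) (b : Q.val N) : Prop :=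
  ∃ (x : P.φ.sol N) (y : Q.φ.sol N), pairTuple x.1 y.1 ∈ θ.sol N ∧
    Submodule.Quotient.mk x = a ∧ Submodule.Quotient.mk y = b

/-! ### The category of pp-pairs for a class of modules -/

/-- The objects of the category of pp-pairs for the class of modules `𝒩 i`, `i : I`. -/
structure PPCat {I : Type*} (𝒩 : I → C ⥤ AddCommGrpCat.{max u v}) where
  pair : PPPair C

variable {I : Type*} {𝒩 : I → C ⥤ AddCommGrpCat.{max u v}}

/-- A pp-definable function between pp-pairs over the modules `𝒩 i`: a function
`φ(𝒩 i)/ψ(𝒩 i) → φ'(𝒩 i)/ψ'(𝒩 i)` for each `i`, such that all of these have the graph defined by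
one pp formula `θ`. -/
@[ext]
structure PPCat.Hom (P Q : PPCat 𝒩) where
  toFun : ∀ i, P.pair.val (𝒩 i) → Q.pair.val (𝒩 i)
  definable : ∃ θ : PPFormula (Sum.elim P.pair.σ Q.pair.σ),
    ∀ i a b, toFun i a = b ↔ θ.rel (𝒩 i) a b

theorem lin_coeff_zero {ι : Type} [Fintype ι] {σ : ι → C} {c : C} (N : C ⥤ AddCommGrpCat.{max u v})
    [N.Additive] (x : ∀ i, N.obj (σ i)) : lin (fun i => (0 : σ i ⟶ c)) N x = 0 :=
  Finset.sum_eq_zero fun i _ => by rw [N.map_zero]; rfl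

theorem lin_coeff_eq_zero {ι : Type} [Fintype ι] {σ : ι → C} {c : C} {g : ∀ i, σ i ⟶ c}
    (N : C ⥤ AddCommGrpCat.{max u v}) [N.Additive] (x : ∀ i, N.obj (σ i)) (h : ∀ i, g i = 0) :
    lin g N x = 0 :=
  Finset.sum_eq_zero fun i _ => by rw [h, N.map_zero]; rfl

/-- The identity function is defined by the formula `x = x'`. -/
noncomputable def idFormula (P : PPPair C) : PPFormula (Sum.elim P.σ P.σ) where
  m := 0
  k := P.n
  τ := Fin.elim0
  ρ := P.σ
  G
    | r, Sum.inl i => if h : i = r then eqToHom (h ▸ rfl) else 0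
    | r, Sum.inr i => if h : i = r then -eqToHom (h ▸ rfl) else 0
  H _ j := j.elim0

theorem mem_sol_idFormula (P : PPPair C) (N : C ⥤ AddCommGrpCat.{max u v}) [N.Additive]
    (x y : ∀ i, N.obj (P.σ i)) : pairTuple x y ∈ (idFormula P).sol N ↔ x = y := by
  have key : ∀ r : Fin P.n, lin ((idFormula P).G r) N (pairTuple x y) = x r - y r := by
    intro r
    rw [lin_pairTuple, sub_eq_add_neg]
    refine congrArg₂ (· + ·) ?_ ?_
    · change ∑ i, (N.map (if h : i = r then eqToHom (h ▸ rfl) else 0)).hom (x i) = x r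
      rw [Finset.sum_eq_single r]
      · rw [dif_pos rfl, eqToHom_refl, N.map_id]; rfl
      · intro i _ hi
        rw [dif_neg hi, N.map_zero]; rfl
      · simp
    · change ∑ i, (N.map (if h : i = r then -eqToHom (h ▸ rfl) else 0)).hom (y i) = -y r
      rw [Finset.sum_eq_single r]
      · rw [dif_pos rfl, eqToHom_refl, N.map_neg, N.map_id]; rfl
      · intro i _ hi
        rw [dif_neg hi, N.map_zero]; rfl
      · simp
  have key' : ∀ (r : Fin P.n) (z : ∀ j, N.obj ((idFormula P).τ j)),
      lin ((idFormula P).G r) N (pairTuple x y) + lin ((idFormula P).H r) N z = x r - y r := by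
    intro r z
    exact (congrArg₂ (· + ·) (key r) (Finset.sum_eq_zero fun j _ => Fin.elim0 j)).trans
      (add_zero (x r - y r))
  constructor
  · rintro ⟨z, hz⟩
    funext r
    exact sub_eq_zero.mp ((key' r z).symm.trans (hz r))
  · rintro rfl
    exact ⟨fun j => Fin.elim0 j, fun r => (key' r _).trans (sub_self _)⟩

/-- The zero function is defined by the formula `ψ'(x')`. -/
def zeroFormula (P Q : PPPair C) : PPFormula (Sum.elim P.σ Q.σ) where
  m := Q.ψ.m
  k := Q.ψ.k
  τ := Q.ψ.τ
  ρ := Q.ψ.ρ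
  G
    | _, Sum.inl _ => 0
    | r, Sum.inr i => Q.ψ.G r i
  H := Q.ψ.H

theorem mem_sol_zeroFormula (P Q : PPPair C) (N : C ⥤ AddCommGrpCat.{max u v}) [N.Additive]
    (x : ∀ i, N.obj (P.σ i)) (y : ∀ i, N.obj (Q.σ i)) :
    pairTuple x y ∈ (zeroFormula P Q).sol N ↔ y ∈ Q.ψ.sol N := by
  have key : ∀ r : Fin Q.ψ.k,
      lin ((zeroFormula P Q).G r) N (pairTuple x y) = lin (Q.ψ.G r) N y := by
    intro r
    rw [lin_pairTuple]
    exact (congrArg₂ (· + ·) (lin_coeff_zero N x) rfl).trans (zero_add (lin (Q.ψ.G r) N y))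
  refine exists_congr fun z => forall_congr' fun r => ?_
  exact Eq.congr (congrArg₂ (· + ·) (key r) rfl) rfl

section comp

variable {P Q R : PPPair C} (θ : PPFormula (Sum.elim P.σ Q.σ)) (θ' : PPFormula (Sum.elim Q.σ R.σ))

/-- The sorts of the quantified variables of `compFormula`. -/
abbrev compτ : (Fin Q.n ⊕ Fin Q.n) ⊕ ((Fin Q.φ.m ⊕ Fin Q.ψ.m) ⊕ (Fin θ.m ⊕ Fin θ'.m)) → C :=
  Sum.elim (Sum.elim Q.σ Q.σ) (Sum.elim (Sum.elim Q.φ.τ Q.ψ.τ) (Sum.elim θ.τ θ'.τ))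

/-- The sorts of the equations of `compFormula`. -/
abbrev compρ : (Fin Q.φ.k ⊕ Fin Q.ψ.k) ⊕ (Fin θ.k ⊕ Fin θ'.k) → C :=
  Sum.elim (Sum.elim Q.φ.ρ Q.ψ.ρ) (Sum.elim θ.ρ θ'.ρ)

/-- The coefficients of the free variables in `compFormula`. -/
def compG : ∀ r i, Sum.elim P.σ R.σ i ⟶ compρ θ θ' r
  | Sum.inr (Sum.inl r), Sum.inl i => θ.G r (Sum.inl i)
  | Sum.inr (Sum.inr r), Sum.inr i => θ'.G r (Sum.inr i)
  | Sum.inl (Sum.inl _), Sum.inl _ => 0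
  | Sum.inl (Sum.inl _), Sum.inr _ => 0
  | Sum.inl (Sum.inr _), Sum.inl _ => 0
  | Sum.inl (Sum.inr _), Sum.inr _ => 0
  | Sum.inr (Sum.inl _), Sum.inr _ => 0
  | Sum.inr (Sum.inr _), Sum.inl _ => 0

/-- The coefficients of the quantified variables in `compFormula`. -/
def compH : ∀ r j, compτ θ θ' j ⟶ compρ θ θ' r
  | Sum.inl (Sum.inl r), Sum.inl (Sum.inl i) => Q.φ.G r i
  | Sum.inl (Sum.inl r), Sum.inr (Sum.inl (Sum.inl j)) => Q.φ.H r j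
  | Sum.inl (Sum.inr r), Sum.inl (Sum.inr i) => Q.ψ.G r i
  | Sum.inl (Sum.inr r), Sum.inr (Sum.inl (Sum.inr j)) => Q.ψ.H r j
  | Sum.inr (Sum.inl r), Sum.inl (Sum.inl i) => θ.G r (Sum.inr i)
  | Sum.inr (Sum.inl r), Sum.inr (Sum.inr (Sum.inl j)) => θ.H r j
  | Sum.inr (Sum.inr r), Sum.inl (Sum.inl i) => θ'.G r (Sum.inl i)
  | Sum.inr (Sum.inr r), Sum.inl (Sum.inr i) => θ'.G r (Sum.inl i)
  | Sum.inr (Sum.inr r), Sum.inr (Sum.inr (Sum.inr j)) => θ'.H r j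
  | _, _ => 0

/-- The composite of the functions defined by `θ` and `θ'` is defined by
`∃ y w, φ'(y) ∧ ψ'(w) ∧ θ(x, y) ∧ θ'(y + w, z)`, where `φ'/ψ'` is the pair in the middle. -/
noncomputable def compFormula : PPFormula (Sum.elim P.σ R.σ) :=
  PPFormula.ofFintype _ _ (compτ θ θ') (compρ θ θ') (compG θ θ') (compH θ θ')

theorem mem_sol_compFormula (N : C ⥤ AddCommGrpCat.{max u v}) [N.Additive]
    (x : ∀ i, N.obj (P.σ i)) (z : ∀ i, N.obj (R.σ i)) :
    pairTuple x z ∈ (compFormula θ θ').sol N ↔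
      ∃ y w : ∀ i, N.obj (Q.σ i), y ∈ Q.φ.sol N ∧ w ∈ Q.ψ.sol N ∧
        pairTuple x y ∈ θ.sol N ∧ pairTuple (y + w) z ∈ θ'.sol N := by
  rw [compFormula, PPFormula.mem_sol_ofFintype]
  simp only [exists_tuple_sum]
  have key : ∀ (y w : ∀ i, N.obj (Q.σ i)) (a : ∀ j, N.obj (Q.φ.τ j)) (b : ∀ j, N.obj (Q.ψ.τ j))
      (c : ∀ j, N.obj (θ.τ j)) (d : ∀ j, N.obj (θ'.τ j)),
      (∀ r, lin (compG θ θ' r) N (pairTuple x z) + lin (compH θ θ' r) N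
        (pairTuple (pairTuple y w) (pairTuple (pairTuple a b) (pairTuple c d))) = 0) ↔
      (∀ r, lin (Q.φ.G r) N y + lin (Q.φ.H r) N a = 0) ∧
      (∀ r, lin (Q.ψ.G r) N w + lin (Q.ψ.H r) N b = 0) ∧
      (∀ r, lin (θ.G r) N (pairTuple x y) + lin (θ.H r) N c = 0) ∧
      (∀ r, lin (θ'.G r) N (pairTuple (y + w) z) + lin (θ'.H r) N d = 0) := by
    intro y w a b c d
    have expand : ∀ r, lin (compG θ θ' r) N (pairTuple x z) + lin (compH θ θ' r) N
        (pairTuple (pairTuple y w) (pairTuple (pairTuple a b) (pairTuple c d))) =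
        (lin (σ := P.σ) (fun i => compG θ θ' r (Sum.inl i)) N x +
          lin (σ := R.σ) (fun i => compG θ θ' r (Sum.inr i)) N z) +
        ((lin (σ := Q.σ) (fun i => compH θ θ' r (Sum.inl (Sum.inl i))) N y +
          lin (σ := Q.σ) (fun i => compH θ θ' r (Sum.inl (Sum.inr i))) N w) +
        ((lin (σ := Q.φ.τ) (fun i => compH θ θ' r (Sum.inr (Sum.inl (Sum.inl i)))) N a +
          lin (σ := Q.ψ.τ) (fun i => compH θ θ' r (Sum.inr (Sum.inl (Sum.inr i)))) N b) +
        (lin (σ := θ.τ) (fun i => compH θ θ' r (Sum.inr (Sum.inr (Sum.inl i)))) N c +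
          lin (σ := θ'.τ) (fun i => compH θ θ' r (Sum.inr (Sum.inr (Sum.inr i)))) N d))) :=
      fun r => congrArg₂ (· + ·) (lin_pairTuple _ N x z) ((lin_pairTuple _ N _ _).trans
        (congrArg₂ (· + ·) (lin_pairTuple _ N y w) ((lin_pairTuple _ N _ _).trans
          (congrArg₂ (· + ·) (lin_pairTuple _ N a b) (lin_pairTuple _ N c d)))))
    have k1 : ∀ r : Fin Q.φ.k, lin (compG θ θ' (Sum.inl (Sum.inl r))) N (pairTuple x z) +
        lin (compH θ θ' (Sum.inl (Sum.inl r))) N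
          (pairTuple (pairTuple y w) (pairTuple (pairTuple a b) (pairTuple c d))) =
        lin (Q.φ.G r) N y + lin (Q.φ.H r) N a := by
      intro r
      have h : (lin (c := Q.φ.ρ r) (σ := P.σ) (fun _ => 0) N x + lin (c := Q.φ.ρ r) (σ := R.σ) (fun _ => 0) N z) +
          ((lin (c := Q.φ.ρ r) (σ := Q.σ) (Q.φ.G r) N y + lin (c := Q.φ.ρ r) (σ := Q.σ) (fun _ => 0) N w) +
          ((lin (c := Q.φ.ρ r) (σ := Q.φ.τ) (Q.φ.H r) N a + lin (c := Q.φ.ρ r) (σ := Q.ψ.τ) (fun _ => 0) N b) +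
          (lin (c := Q.φ.ρ r) (σ := θ.τ) (fun _ => 0) N c + lin (c := Q.φ.ρ r) (σ := θ'.τ) (fun _ => 0) N d))) =
          lin (Q.φ.G r) N y + lin (Q.φ.H r) N a := by
        simp only [lin_coeff_zero, add_zero, zero_add]
      exact (expand (Sum.inl (Sum.inl r))).trans h
    have k2 : ∀ r : Fin Q.ψ.k, lin (compG θ θ' (Sum.inl (Sum.inr r))) N (pairTuple x z) +
        lin (compH θ θ' (Sum.inl (Sum.inr r))) N
          (pairTuple (pairTuple y w) (pairTuple (pairTuple a b) (pairTuple c d))) =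
        lin (Q.ψ.G r) N w + lin (Q.ψ.H r) N b := by
      intro r
      have h : (lin (c := Q.ψ.ρ r) (σ := P.σ) (fun _ => 0) N x + lin (c := Q.ψ.ρ r) (σ := R.σ) (fun _ => 0) N z) +
          ((lin (c := Q.ψ.ρ r) (σ := Q.σ) (fun _ => 0) N y + lin (c := Q.ψ.ρ r) (σ := Q.σ) (Q.ψ.G r) N w) +
          ((lin (c := Q.ψ.ρ r) (σ := Q.φ.τ) (fun _ => 0) N a + lin (c := Q.ψ.ρ r) (σ := Q.ψ.τ) (Q.ψ.H r) N b) +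
          (lin (c := Q.ψ.ρ r) (σ := θ.τ) (fun _ => 0) N c + lin (c := Q.ψ.ρ r) (σ := θ'.τ) (fun _ => 0) N d))) =
          lin (Q.ψ.G r) N w + lin (Q.ψ.H r) N b := by
        simp only [lin_coeff_zero, add_zero, zero_add]
      exact (expand (Sum.inl (Sum.inr r))).trans h
    have k3 : ∀ r : Fin θ.k, lin (compG θ θ' (Sum.inr (Sum.inl r))) N (pairTuple x z) +
        lin (compH θ θ' (Sum.inr (Sum.inl r))) N
          (pairTuple (pairTuple y w) (pairTuple (pairTuple a b) (pairTuple c d))) =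
        lin (θ.G r) N (pairTuple x y) + lin (θ.H r) N c := by
      intro r
      have h : (lin (c := θ.ρ r) (σ := P.σ) (fun i => θ.G r (Sum.inl i)) N x + lin (c := θ.ρ r) (σ := R.σ) (fun _ => 0) N z) +
          ((lin (c := θ.ρ r) (σ := Q.σ) (fun i => θ.G r (Sum.inr i)) N y + lin (c := θ.ρ r) (σ := Q.σ) (fun _ => 0) N w) +
          ((lin (c := θ.ρ r) (σ := Q.φ.τ) (fun _ => 0) N a + lin (c := θ.ρ r) (σ := Q.ψ.τ) (fun _ => 0) N b) +
          (lin (c := θ.ρ r) (σ := θ.τ) (θ.H r) N c + lin (c := θ.ρ r) (σ := θ'.τ) (fun _ => 0) N d))) =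
          lin (θ.G r) N (pairTuple x y) + lin (θ.H r) N c := by
        simp only [lin_coeff_zero, lin_pairTuple, add_zero, zero_add]
        abel
      exact (expand (Sum.inr (Sum.inl r))).trans h
    have k4 : ∀ r : Fin θ'.k, lin (compG θ θ' (Sum.inr (Sum.inr r))) N (pairTuple x z) +
        lin (compH θ θ' (Sum.inr (Sum.inr r))) N
          (pairTuple (pairTuple y w) (pairTuple (pairTuple a b) (pairTuple c d))) =
        lin (θ'.G r) N (pairTuple (y + w) z) + lin (θ'.H r) N d := by
      intro r
      have h : (lin (c := θ'.ρ r) (σ := P.σ) (fun _ => 0) N x + lin (c := θ'.ρ r) (σ := R.σ) (fun i => θ'.G r (Sum.inr i)) N z) +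
          ((lin (c := θ'.ρ r) (σ := Q.σ) (fun i => θ'.G r (Sum.inl i)) N y + lin (c := θ'.ρ r) (σ := Q.σ) (fun i => θ'.G r (Sum.inl i)) N w) +
          ((lin (c := θ'.ρ r) (σ := Q.φ.τ) (fun _ => 0) N a + lin (c := θ'.ρ r) (σ := Q.ψ.τ) (fun _ => 0) N b) +
          (lin (c := θ'.ρ r) (σ := θ.τ) (fun _ => 0) N c + lin (c := θ'.ρ r) (σ := θ'.τ) (θ'.H r) N d))) =
          lin (θ'.G r) N (pairTuple (y + w) z) + lin (θ'.H r) N d := by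
        have e := lin_tuple_add (σ := Q.σ) (fun i => θ'.G r (Sum.inl i)) N y w
        rw [lin_pairTuple, e]
        simp only [lin_coeff_zero, add_zero, zero_add]
        abel
      exact (expand (Sum.inr (Sum.inr r))).trans h
    constructor
    · intro h
      exact ⟨fun r => (k1 r).symm.trans (h _), fun r => (k2 r).symm.trans (h _),
        fun r => (k3 r).symm.trans (h _), fun r => (k4 r).symm.trans (h _)⟩
    · rintro ⟨h1, h2, h3, h4⟩ ((r | r) | (r | r))
      · exact (k1 r).trans (h1 r)
      · exact (k2 r).trans (h2 r)
      · exact (k3 r).trans (h3 r)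
      · exact (k4 r).trans (h4 r)
  constructor
  · rintro ⟨y, w, a, b, c, d, h⟩
    obtain ⟨h1, h2, h3, h4⟩ := (key y w a b c d).1 h
    exact ⟨y, w, ⟨a, h1⟩, ⟨b, h2⟩, ⟨c, h3⟩, ⟨d, h4⟩⟩
  · rintro ⟨y, w, ⟨a, h1⟩, ⟨b, h2⟩, ⟨c, h3⟩, ⟨d, h4⟩⟩
    exact ⟨y, w, a, b, c, d, (key y w a b c d).2 ⟨h1, h2, h3, h4⟩⟩

end comp

theorem rel_idFormula (P : PPPair C) (N : C ⥤ AddCommGrpCat.{max u v}) [N.Additive]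
    (a b : P.val N) : (idFormula P).rel N a b ↔ a = b := by
  constructor
  · rintro ⟨x, y, h, rfl, rfl⟩
    rw [mem_sol_idFormula] at h
    rw [Subtype.ext h]
  · rintro rfl
    obtain ⟨x, rfl⟩ := Submodule.Quotient.mk_surjective _ a
    exact ⟨x, x, (mem_sol_idFormula P N x.1 x.1).2 rfl, rfl, rfl⟩

theorem rel_zeroFormula (P Q : PPPair C) (N : C ⥤ AddCommGrpCat.{max u v}) [N.Additive]
    (a : P.val N) (b : Q.val N) : (zeroFormula P Q).rel N a b ↔ 0 = b := by
  constructor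
  · rintro ⟨x, y, h, rfl, rfl⟩
    rw [mem_sol_zeroFormula] at h
    exact ((PPPair.mk_eq_zero y).2 h).symm
  · rintro rfl
    obtain ⟨x, rfl⟩ := Submodule.Quotient.mk_surjective _ a
    exact ⟨x, 0, (mem_sol_zeroFormula P Q N _ _).2 (zero_mem _), rfl, rfl⟩

theorem rel_compFormula {P Q R : PPPair C} (θ : PPFormula (Sum.elim P.σ Q.σ))
    (θ' : PPFormula (Sum.elim Q.σ R.σ)) (N : C ⥤ AddCommGrpCat.{max u v}) [hN : N.Additive]
    (a : P.val N) (c : R.val N) :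
    (compFormula θ θ').rel N a c ↔ ∃ b, θ.rel N a b ∧ θ'.rel N b c := by
  constructor
  · rintro ⟨x, z, h, rfl, rfl⟩
    rw [mem_sol_compFormula] at h
    obtain ⟨y, w, hy, hw, h1, h2⟩ := h
    refine ⟨Submodule.Quotient.mk ⟨y, hy⟩, ⟨x, ⟨y, hy⟩, h1, rfl, rfl⟩,
      ⟨⟨y + w, add_mem hy (Q.le N hN hw)⟩, z, h2, ?_, rfl⟩⟩
    rw [PPPair.mk_eq_mk]
    change y + w - y ∈ Q.ψ.sol N
    rwa [add_sub_cancel_left]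
  · rintro ⟨b, ⟨x, y, h1, rfl, rfl⟩, ⟨y', z, h2, hy, rfl⟩⟩
    rw [PPPair.mk_eq_mk] at hy
    refine ⟨x, z, (mem_sol_compFormula θ θ' N _ _).2
      ⟨y.1, y'.1 - y.1, y.2, hy, h1, ?_⟩, rfl, rfl⟩
    rwa [add_sub_cancel]

section Category

variable [∀ i, (𝒩 i).Additive]

/-- The category of pp-pairs and pp-definable functions for the class of modules `𝒩 i`. -/
noncomputable instance : Category (PPCat 𝒩) where
  Hom := PPCat.Hom
  id P := ⟨fun _ a => a, idFormula P.pair, fun i a b => (rel_idFormula P.pair (𝒩 i) a b).symm⟩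
  comp {P Q R} f g := ⟨fun i a => g.toFun i (f.toFun i a), by
    obtain ⟨θ, hθ⟩ := f.definable
    obtain ⟨θ', hθ'⟩ := g.definable
    refine ⟨compFormula θ θ', fun i a b => ?_⟩
    rw [rel_compFormula]
    simp only [← hθ, ← hθ']
    simp⟩

noncomputable instance : HasZeroMorphisms (PPCat 𝒩) where
  zero P Q := ⟨⟨fun _ _ => 0, zeroFormula P.pair Q.pair,
    fun i a b => (rel_zeroFormula P.pair Q.pair (𝒩 i) a b).symm⟩⟩
  comp_zero _ _ := rfl
  zero_comp P {Q R} f := by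
    obtain ⟨θ, hθ⟩ := f.definable
    refine PPCat.Hom.ext (funext fun i => funext fun a => ?_)
    refine (hθ i 0 0).2 ⟨0, 0, ?_, rfl, rfl⟩
    convert zero_mem (θ.sol (𝒩 i)) using 1
    funext j
    rcases j with j | j <;> rfl

/-- A pp-definable function between pp-pairs is a homomorphism of modules over the endomorphism
ring. -/
def PPCat.Hom.linear {P Q : PPCat 𝒩} (f : PPCat.Hom P Q) (i : I) :
    P.pair.val (𝒩 i) →ₗ[End (𝒩 i)] Q.pair.val (𝒩 i) where
  toFun := f.toFun i
  map_add' a b := by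
    obtain ⟨θ, hθ⟩ := f.definable
    obtain ⟨x, y, h, hx, hy⟩ := (hθ i a _).1 rfl
    obtain ⟨x', y', h', hx', hy'⟩ := (hθ i b _).1 rfl
    refine (hθ i _ _).2 ⟨x + x', y + y', ?_, ?_, ?_⟩
    · convert add_mem h h' using 1
      funext j
      rcases j with j | j <;> rfl
    · rw [Submodule.Quotient.mk_add, hx, hx']
    · rw [Submodule.Quotient.mk_add, hy, hy']
  map_smul' s a := by
    obtain ⟨θ, hθ⟩ := f.definable
    obtain ⟨x, y, h, hx, hy⟩ := (hθ i a _).1 rfl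
    refine (hθ i _ _).2 ⟨s • x, s • y, ?_, ?_, ?_⟩
    · convert Submodule.smul_mem _ s h using 1
      funext j
      rcases j with j | j <;> rfl
    · rw [Submodule.Quotient.mk_smul, hx]
    · rw [Submodule.Quotient.mk_smul, hy]; rfl

variable (𝒩) in
/-- Evaluation at the module `𝒩 i`: it takes `φ/ψ` to the left `End (𝒩 i)`-module
`φ(𝒩 i)/ψ(𝒩 i)`. -/
noncomputable def evalAt (i : I) : PPCat 𝒩 ⥤ ModuleCat.{max u v} (End (𝒩 i)) where
  obj P := ModuleCat.of _ (P.pair.val (𝒩 i))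
  map f := ModuleCat.ofHom (PPCat.Hom.linear f i)

end Category

/-! ### Localisation, definable subcategories -/

section Serre

variable {A : Type*} [Category A] [HasZeroMorphisms A]

/-- The morphisms which have a kernel and a cokernel belonging to the class `𝒮`. -/
def isoModulo (𝒮 : ObjectProperty A) : MorphismProperty A := fun X Y f =>
  (∃ (K : A) (ι : K ⟶ X) (w : ι ≫ f = 0), Nonempty (IsLimit (KernelFork.ofι ι w)) ∧ 𝒮 K) ∧
  (∃ (L : A) (π : Y ⟶ L) (w : f ≫ π = 0), Nonempty (IsColimit (CokernelCofork.ofπ π w)) ∧ 𝒮 L)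

/-- The quotient category `A/𝒮`: the localisation of `A` inverting the morphisms whose kernel and
cokernel are in `𝒮`. -/
abbrev SerreQuotient (𝒮 : ObjectProperty A) := (isoModulo 𝒮).Localization

end Serre

variable (C) in
/-- The family of all left `C`-modules. -/
abbrev allModules : {N : C ⥤ AddCommGrpCat.{max u v} // N.Additive} →
    C ⥤ AddCommGrpCat.{max u v} := Subtype.val

instance (N : {N : C ⥤ AddCommGrpCat.{max u v} // N.Additive}) : (allModules C N).Additive := N.2

/-- An embedding `f` of `A` in `B` is pure if `φ(A) = A^n ∩ φ(B)` for every pp formula `φ`. -/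
def IsPure {A B : C ⥤ AddCommGrpCat.{max u v}} (f : A ⟶ B) : Prop :=
  (∀ c, Function.Injective (f.app c).hom) ∧
  ∀ (n : ℕ) (σ : Fin n → C) (φ : PPFormula σ) (x : ∀ i, A.obj (σ i)),
    x ∈ φ.sol A ↔ (fun i => (f.app (σ i)).hom (x i)) ∈ φ.sol B

/-- Definable subcategories of the category of left `C`-modules (full, closed under isomorphisms):
those closed under direct products, direct limits (colimits of directed systems) and pure
submodules. -/
structure IsDefinable (𝒟 : ObjectProperty (C ⥤ AddCommGrpCat.{max u v})) : Prop where
  additive : ∀ N, 𝒟 N → N.Additive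
  iso : 𝒟.IsClosedUnderIsomorphisms
  prod : ∀ J : Type (max u v), 𝒟.IsClosedUnderLimitsOfShape (Discrete J)
  directLimit : ∀ (J : Type (max u v)) [Preorder J] [IsDirectedOrder J] [Nonempty J],
    𝒟.IsClosedUnderColimitsOfShape J
  pure : ∀ (A B : C ⥤ AddCommGrpCat.{max u v}) (f : A ⟶ B), A.Additive → IsPure f → 𝒟 B → 𝒟 A

/-- The definable subcategory generated by `M`: the smallest one containing `M`. -/
def definableClosure (M : C ⥤ AddCommGrpCat.{max u v}) :
    ObjectProperty (C ⥤ AddCommGrpCat.{max u v}) :=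
  fun N => N.Additive ∧ ∀ 𝒟, IsDefinable 𝒟 → 𝒟 M → 𝒟 N

/-- The family of the modules in a class `𝒟`. -/
abbrev modulesIn (𝒟 : ObjectProperty (C ⥤ AddCommGrpCat.{max u v})) :
    {N : C ⥤ AddCommGrpCat.{max u v} // 𝒟 N} → C ⥤ AddCommGrpCat.{max u v} := Subtype.val

instance (M : C ⥤ AddCommGrpCat.{max u v})
    (N : {N : C ⥤ AddCommGrpCat.{max u v} // definableClosure M N}) :
    (modulesIn (definableClosure M) N).Additive := N.2.1

/-- The pp-pairs `φ/ψ` with `φ(D)/ψ(D) = 0` for every `D` in `𝒟`. -/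
def closedOn (𝒟 : ObjectProperty (C ⥤ AddCommGrpCat.{max u v})) :
    ObjectProperty (PPCat (allModules C)) :=
  fun P => ∀ D, 𝒟 D → Subsingleton (P.pair.val D)

/-- The functor category of a definable subcategory `𝒟`: the quotient of the category of all
pp-pairs for `C`-modules by the Serre subcategory of the pairs that are closed on `𝒟`. -/
noncomputable abbrev FunctorCategory (𝒟 : ObjectProperty (C ⥤ AddCommGrpCat.{max u v})) :=
  SerreQuotient (closedOn 𝒟)

/-- The quotient functor from pp-pairs for all `C`-modules to the functor category of `𝒟`. -/
noncomputable abbrev quotientFunctor (𝒟 : ObjectProperty (C ⥤ AddCommGrpCat.{max u v})) :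
    PPCat (allModules C) ⥤ FunctorCategory 𝒟 :=
  (isoModulo (closedOn 𝒟)).Q

/-! ### Finiteness conditions -/

/-- `M` is finitely presented: it has finitely many generators `a i` (of sort `σ i`), and all the
linear relations between these are consequences of finitely many, the `r`-th of which reads
`∑ i, g r i (a i) = 0` in sort `ρ r`. That is, there is an exact sequence
`⨁ r, (ρ r, -) ⟶ ⨁ i, (σ i, -) ⟶ M ⟶ 0`. -/
def IsFinitelyPresented (M : C ⥤ AddCommGrpCat.{max u v}) : Prop :=
  ∃ (n : ℕ) (σ : Fin n → C) (a : ∀ i, M.obj (σ i)) (k : ℕ) (ρ : Fin k → C)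
    (g : ∀ (r : Fin k) (i : Fin n), σ i ⟶ ρ r),
    (∀ (c : C) (x : M.obj c), ∃ f : ∀ i, σ i ⟶ c, lin f M a = x) ∧
    (∀ r, lin (g r) M a = 0) ∧
    (∀ (c : C) (f : ∀ i, σ i ⟶ c), lin f M a = 0 →
      ∃ t : ∀ r, ρ r ⟶ c, ∀ i, f i = ∑ r, g r i ≫ t r)

/-- `M` is noetherian over its endomorphism ring `S = End M`: each sort of `M` is a noetherian left
`S`-module. -/
def IsEndoNoetherian (M : C ⥤ AddCommGrpCat.{max u v}) : Prop :=
  ∀ c : C, IsNoetherian (End M) (M.obj c)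

/-- The category of finitely presented left modules over the ring `S`. -/
abbrev FPModuleCat (S : Type w) [Ring S] :=
  ObjectProperty.FullSubcategory
    (fun A : ModuleCat.{w} S => Module.FinitePresentation S A)

/-- The inclusion of the finitely presented left `S`-modules in all left `S`-modules. -/
abbrev FPModuleCat.incl (S : Type w) [Ring S] : FPModuleCat S ⥤ ModuleCat.{w} S :=
  ObjectProperty.ι _

end MultisortedModule

open MultisortedModule

/-!
Let `S = End M`. Evaluation at `M` sends a pp-pair `φ/ψ` to a subquotient of a finite product of
sorts of `M`, hence to a noetherian `S`-module. A presentation of `M` with generators `a` embeds `S`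
in such a product by `s ↦ s • a`, so `S` is left noetherian, and evaluation takes values in the
finitely presented `S`-modules (`IsFinitelyPresented.finitePresentation_val`).

The point where finite presentation matters is that every `S`-submodule of a finite product of sorts
of `M` is the solution set of a pp formula
(`IsFinitelyPresented.exists_sol_eq_of_isEndoNoetherian`): it is finitely generated, and the cyclic
submodule generated by `b = f(a)` consists of the `f(z)`, where `z` satisfies the defining relations
of `a`, because these `z` are exactly the images of `a` under endomorphisms. Hence

* every finitely generated `S`-module `Sⁿ/K` is the value of a pp-pair: `Sⁿ` is the solution set of
  `n` copies of the defining relations and `K` is pp-definable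
  (`IsFinitelyPresented.exists_val_equiv`);
* every `S`-homomorphism between values at `M` of pp-pairs has a pp-definable graph `R`, and is the
  fraction `t s⁻¹` of the projections of `R`, where `s` is bijective at `M` (`PPCat.exists_roof`).

Kernels, cokernels and equalizers of pp-definable functions are again pp-pairs, computed pointwise.
Since the modules `N` with `φ(N) ≤ ψ(N)` form a definable class (`isDefinable_solLE`), a pp-pair
which is zero at `M` is zero on the definable class `𝒟` generated by `M`; so a pp-definable function
which is bijective at `M` is bijective on `𝒟`. Over `𝒟`, or over `M` alone, such a function is
therefore invertible, and the roofs and equalizers show that evaluation is full and faithful. Over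
all modules, these functions are precisely the morphisms inverted in the functor category
(`isoModulo_closedOn_definableClosure_iff`), and the same roofs and equalizers identify the
localisation with the finitely presented `S`-modules (`exists_localization_equivalence`).
-/

namespace MultisortedModule

/-! ### Calculus of linear terms and pp-definable conditions -/

section Calculus

variable {C : Type u} [Category.{v} C]

theorem map_lin {ι : Type} [Fintype ι] {σ : ι → C} {c d : C} (g : ∀ i, σ i ⟶ c) (f : c ⟶ d)
    (N : C ⥤ AddCommGrpCat.{max u v}) (x : ∀ i, N.obj (σ i)) :
    (N.map f).hom (lin g N x) = lin (fun i => g i ≫ f) N x := by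
  simp only [lin, map_sum, N.map_comp]
  rfl

theorem hom_lin {ι : Type} [Fintype ι] {σ : ι → C} {c : C} (g : ∀ i, σ i ⟶ c)
    {N N' : C ⥤ AddCommGrpCat.{max u v}} (f : N ⟶ N') (x : ∀ i, N.obj (σ i)) :
    (f.app c).hom (lin g N x) = lin g N' (fun i => (f.app (σ i)).hom (x i)) := by
  simp only [lin, map_sum]
  refine Finset.sum_congr rfl fun i _ => ?_
  exact congrArg (fun h => h.hom (x i)) (f.naturality (g i))

theorem hom_lin_add_lin {ι κ : Type} [Fintype ι] [Fintype κ] {σ : ι → C} {σ' : κ → C} {c : C}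
    (g : ∀ i, σ i ⟶ c) (h : ∀ j, σ' j ⟶ c) {N N' : C ⥤ AddCommGrpCat.{max u v}} (f : N ⟶ N')
    (x : ∀ i, N.obj (σ i)) (y : ∀ j, N.obj (σ' j)) :
    (f.app c).hom (lin g N x + lin h N y) =
      lin g N' (fun i => (f.app (σ i)).hom (x i)) + lin h N' (fun j => (f.app (σ' j)).hom (y j)) := by
  rw [map_add, hom_lin, hom_lin]

/-- Homomorphisms of modules preserve pp formulas. -/
theorem PPFormula.map_mem_sol {ι : Type} [Fintype ι] {σ : ι → C} (φ : PPFormula σ)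
    {N N' : C ⥤ AddCommGrpCat.{max u v}} (f : N ⟶ N') {x : ∀ i, N.obj (σ i)}
    (hx : x ∈ φ.sol N) : (fun i => (f.app (σ i)).hom (x i)) ∈ φ.sol N' := by
  obtain ⟨y, hy⟩ := hx
  refine ⟨fun j => (f.app _).hom (y j), fun r => ?_⟩
  rw [← hom_lin_add_lin, hy r, map_zero]

variable [Preadditive C]

theorem lin_coeff_add {ι : Type} [Fintype ι] {σ : ι → C} {c : C} (g h : ∀ i, σ i ⟶ c)
    (N : C ⥤ AddCommGrpCat.{max u v}) [N.Additive] (x : ∀ i, N.obj (σ i)) :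
    lin (fun i => g i + h i) N x = lin g N x + lin h N x := by
  simp only [lin, N.map_add, ← Finset.sum_add_distrib]
  rfl

theorem lin_coeff_neg {ι : Type} [Fintype ι] {σ : ι → C} {c : C} (g : ∀ i, σ i ⟶ c)
    (N : C ⥤ AddCommGrpCat.{max u v}) [N.Additive] (x : ∀ i, N.obj (σ i)) :
    lin (fun i => -g i) N x = -lin g N x := by
  simp only [lin, N.map_neg, ← Finset.sum_neg_distrib]
  rfl

theorem lin_coeff_sum {ι κ : Type} [Fintype ι] [Fintype κ] {σ : ι → C} {c : C}
    (g : κ → ∀ i, σ i ⟶ c) (N : C ⥤ AddCommGrpCat.{max u v}) [N.Additive]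
    (x : ∀ i, N.obj (σ i)) : lin (fun i => ∑ k, g k i) N x = ∑ k, lin (g k) N x := by
  have h : ∀ i, (N.map (∑ k, g k i)).hom (x i) = ∑ k, (N.map (g k i)).hom (x i) := by
    intro i
    rw [N.map_sum]
    exact congrArg (fun (F : N.obj (σ i) →+ N.obj c) => F (x i))
      (map_sum (AddCommGrpCat.homAddEquiv (M := N.obj (σ i)) (N := N.obj c)) _ _) |>.trans
      (AddMonoidHom.finsetSum_apply _ _ _)
  simp only [lin, h]
  exact Finset.sum_comm

/-- A term in the variables `x i` of sort `σ i`, given by its values in all modules, which agrees in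
the additive modules with a linear form. -/
def IsLin {ι : Type} [Fintype ι] (σ : ι → C) {c : C}
    (t : ∀ N : C ⥤ AddCommGrpCat.{max u v}, (∀ i, N.obj (σ i)) → N.obj c) : Prop :=
  ∃ g : ∀ i, σ i ⟶ c, ∀ N : C ⥤ AddCommGrpCat.{max u v}, N.Additive → ∀ x, t N x = lin g N x

/-- A condition on the variables `x i` of sort `σ i`, given by its truth values in all modules,
which is expressed in the additive modules by a pp formula. -/
def IsPP {ι : Type} [Fintype ι] (σ : ι → C)
    (p : ∀ N : C ⥤ AddCommGrpCat.{max u v}, (∀ i, N.obj (σ i)) → Prop) : Prop :=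
  ∃ φ : PPFormula σ, ∀ N : C ⥤ AddCommGrpCat.{max u v}, N.Additive → ∀ x, x ∈ φ.sol N ↔ p N x

variable {ι κ : Type} [Fintype ι] [Fintype κ] {σ : ι → C} {σ' : κ → C} {c d : C}

theorem IsLin.of_lin (g : ∀ i, σ i ⟶ c) : IsLin.{u, v} σ (fun N x => lin g N x) :=
  ⟨g, fun _ _ _ => rfl⟩

theorem IsLin.coord (i : ι) : IsLin.{u, v} σ (fun _ x => x i) := by
  classical
  refine ⟨fun j => if h : j = i then eqToHom (h ▸ rfl) else 0, fun N hN x => ?_⟩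
  rw [lin, Finset.sum_eq_single i]
  · rw [dif_pos rfl, eqToHom_refl, N.map_id]; rfl
  · intro j _ hj
    rw [dif_neg hj, N.map_zero]; rfl
  · simp

theorem IsLin.sub {s t : ∀ N : C ⥤ AddCommGrpCat.{max u v}, (∀ i, N.obj (σ i)) → N.obj c}
    (hs : IsLin σ s) (ht : IsLin σ t) : IsLin σ (fun N x => s N x - t N x) := by
  obtain ⟨g, hg⟩ := hs
  obtain ⟨h, hh⟩ := ht
  refine ⟨fun i => g i + -h i, fun N hN x => (congrArg₂ (· - ·) (hg N hN x) (hh N hN x)).trans ?_⟩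
  rw [lin_coeff_add, lin_coeff_neg, sub_eq_add_neg]

theorem IsLin.subst {t : ∀ N : C ⥤ AddCommGrpCat.{max u v}, (∀ j, N.obj (σ' j)) → N.obj c}
    (ht : IsLin σ' t)
    {s : ∀ j, ∀ N : C ⥤ AddCommGrpCat.{max u v}, (∀ i, N.obj (σ i)) → N.obj (σ' j)}
    (hs : ∀ j, IsLin σ (s j)) : IsLin σ (fun N x => t N (fun j => s j N x)) := by
  obtain ⟨g, hg⟩ := ht
  choose h hh using hs
  change ∀ j, ∀ N : C ⥤ AddCommGrpCat.{max u v}, N.Additive → ∀ x, s j N x = lin (h j) N x at hh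
  refine ⟨fun i => ∑ j, h j i ≫ g j, fun N hN x => (hg N hN _).trans ?_⟩
  rw [lin_coeff_sum (fun j i => h j i ≫ g j)]
  refine Finset.sum_congr rfl fun j _ => ?_
  exact (congrArg _ (hh j N hN x)).trans (map_lin _ _ N x)

theorem IsLin.lin_comp (g : ∀ j, σ' j ⟶ c)
    {s : ∀ j, ∀ N : C ⥤ AddCommGrpCat.{max u v}, (∀ i, N.obj (σ i)) → N.obj (σ' j)}
    (hs : ∀ j, IsLin σ (s j)) : IsLin σ (fun N x => lin g N (fun j => s j N x)) :=
  (IsLin.of_lin g).subst hs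

theorem IsPP.congr {p q : ∀ N : C ⥤ AddCommGrpCat.{max u v}, (∀ i, N.obj (σ i)) → Prop}
    (hp : IsPP σ p) (h : ∀ N : C ⥤ AddCommGrpCat.{max u v}, N.Additive → ∀ x, p N x ↔ q N x) :
    IsPP σ q := by
  obtain ⟨φ, hφ⟩ := hp
  exact ⟨φ, fun N hN x => (hφ N hN x).trans (h N hN x)⟩

theorem IsPP.sol (φ : PPFormula σ) : IsPP.{u, v} σ (fun N x => x ∈ φ.sol N) :=
  ⟨φ, fun _ _ _ => Iff.rfl⟩

theorem IsPP.true : IsPP.{u, v} σ (fun _ _ => True) :=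
  ⟨⟨0, 0, Fin.elim0, Fin.elim0, fun r => r.elim0, fun r => r.elim0⟩,
    fun _ _ _ => ⟨fun _ => trivial, fun _ => ⟨fun j => Fin.elim0 j, fun r => r.elim0⟩⟩⟩

theorem IsPP.eq_zero {t : ∀ N : C ⥤ AddCommGrpCat.{max u v}, (∀ i, N.obj (σ i)) → N.obj c}
    (ht : IsLin σ t) : IsPP σ (fun N x => t N x = 0) := by
  obtain ⟨g, hg⟩ := ht
  refine ⟨⟨0, 1, Fin.elim0, fun _ => c, fun _ => g, fun _ j => j.elim0⟩, fun N hN x => ?_⟩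
  have e : ∀ y : ∀ j : Fin 0, N.obj (Fin.elim0 j : C),
      lin (c := c) (fun j => j.elim0) N y = 0 := fun y => lin_empty _ _ _
  change _ ↔ t N x = 0
  rw [hg N hN]
  constructor
  · rintro ⟨y, hy⟩
    exact (add_zero _).symm.trans ((congrArg _ (e y)).symm.trans (hy 0))
  · intro h
    refine ⟨fun j => Fin.elim0 j, fun r => ?_⟩
    exact (congrArg _ (e _)).trans ((add_zero _).trans h)

theorem IsPP.eq {s t : ∀ N : C ⥤ AddCommGrpCat.{max u v}, (∀ i, N.obj (σ i)) → N.obj c}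
    (hs : IsLin σ s) (ht : IsLin σ t) : IsPP σ (fun N x => s N x = t N x) :=
  (IsPP.eq_zero (hs.sub ht)).congr fun _ _ _ => sub_eq_zero

theorem IsPP.subst {p : ∀ N : C ⥤ AddCommGrpCat.{max u v}, (∀ j, N.obj (σ' j)) → Prop}
    (hp : IsPP σ' p)
    {t : ∀ j, ∀ N : C ⥤ AddCommGrpCat.{max u v}, (∀ i, N.obj (σ i)) → N.obj (σ' j)}
    (ht : ∀ j, IsLin σ (t j)) : IsPP σ (fun N x => p N (fun j => t j N x)) := by
  obtain ⟨φ, hφ⟩ := hp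
  choose g hg using fun r => IsLin.lin_comp (φ.G r) ht
  refine ⟨⟨φ.m, φ.k, φ.τ, φ.ρ, g, φ.H⟩, fun N hN x => ?_⟩
  refine Iff.trans ?_ (hφ N hN _)
  refine exists_congr fun y => forall_congr' fun r => ?_
  exact Eq.congr (congrArg₂ (· + ·) (hg r N hN x).symm rfl) rfl

/-- Existential quantification. -/
theorem IsPP.exists
    {p : ∀ N : C ⥤ AddCommGrpCat.{max u v}, (∀ i, N.obj (σ i)) → (∀ j, N.obj (σ' j)) → Prop}
    (hp : IsPP (Sum.elim σ σ') (fun N z => p N (fun i => z (Sum.inl i)) (fun j => z (Sum.inr j)))) :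
    IsPP σ (fun N x => ∃ y, p N x y) := by
  obtain ⟨φ, hφ⟩ := hp
  refine ⟨PPFormula.ofFintype (κ ⊕ Fin φ.m) (Fin φ.k) (Sum.elim σ' φ.τ) φ.ρ
    (fun r i => φ.G r (Sum.inl i)) (fun r j => match j with
      | Sum.inl j => φ.G r (Sum.inr j)
      | Sum.inr j => φ.H r j), fun N hN x => ?_⟩
  refine (PPFormula.mem_sol_ofFintype _ _ _ _ _ _ N x).trans (exists_tuple_sum.trans ?_)
  refine exists_congr fun y => Iff.trans ?_ (hφ N hN (pairTuple x y))
  refine exists_congr fun z => forall_congr' fun r => Eq.congr ?_ rfl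
  refine (congrArg₂ (· + ·) rfl (lin_pairTuple _ N y z)).trans ?_
  refine (add_assoc _ _ _).symm.trans (congrArg₂ (· + ·) ?_ rfl)
  exact (lin_pairTuple _ N x y).symm

theorem IsPP.and {p q : ∀ N : C ⥤ AddCommGrpCat.{max u v}, (∀ i, N.obj (σ i)) → Prop}
    (hp : IsPP σ p) (hq : IsPP σ q) : IsPP σ (fun N x => p N x ∧ q N x) := by
  obtain ⟨φ, hφ⟩ := hp
  obtain ⟨ψ, hψ⟩ := hq
  refine ⟨PPFormula.ofFintype (Fin φ.m ⊕ Fin ψ.m) (Fin φ.k ⊕ Fin ψ.k) (Sum.elim φ.τ ψ.τ)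
    (Sum.elim φ.ρ ψ.ρ)
    (fun r i => match r with
      | Sum.inl r => φ.G r i
      | Sum.inr r => ψ.G r i)
    (fun r => match r with
      | Sum.inl r => fun j => match j with
        | Sum.inl j => φ.H r j
        | Sum.inr _ => 0
      | Sum.inr r => fun j => match j with
        | Sum.inl _ => 0
        | Sum.inr j => ψ.H r j), fun N hN x => ?_⟩
  refine ((PPFormula.mem_sol_ofFintype _ _ _ _ _ _ N x).trans exists_tuple_sum).trans
    (Iff.trans ?_ (and_congr (hφ N hN x) (hψ N hN x)))
  have hl : ∀ (y : ∀ j, N.obj (φ.τ j)) (z : ∀ j, N.obj (ψ.τ j)) (r : Fin φ.k),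
      lin (φ.G r) N x + lin (c := φ.ρ r) (fun j : Fin φ.m ⊕ Fin ψ.m => match j with
        | Sum.inl j => φ.H r j
        | Sum.inr _ => 0) N (pairTuple (σ := φ.τ) (σ' := ψ.τ) y z) =
      lin (φ.G r) N x + lin (φ.H r) N y := fun y z r =>
    congrArg₂ (· + ·) rfl ((lin_pairTuple _ N y z).trans
      ((congrArg₂ (· + ·) rfl (lin_coeff_zero N z)).trans (add_zero _)))
  have hr : ∀ (y : ∀ j, N.obj (φ.τ j)) (z : ∀ j, N.obj (ψ.τ j)) (r : Fin ψ.k),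
      lin (ψ.G r) N x + lin (c := ψ.ρ r) (fun j : Fin φ.m ⊕ Fin ψ.m => match j with
        | Sum.inl _ => 0
        | Sum.inr j => ψ.H r j) N (pairTuple (σ := φ.τ) (σ' := ψ.τ) y z) =
      lin (ψ.G r) N x + lin (ψ.H r) N z := fun y z r =>
    congrArg₂ (· + ·) rfl ((lin_pairTuple _ N y z).trans
      ((congrArg₂ (· + ·) (lin_coeff_zero N y) rfl).trans (zero_add _)))
  constructor
  · rintro ⟨y, z, h⟩
    exact ⟨⟨y, fun r => (hl y z r).symm.trans (h (Sum.inl r))⟩,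
      ⟨z, fun r => (hr y z r).symm.trans (h (Sum.inr r))⟩⟩
  · rintro ⟨⟨y, hy⟩, ⟨z, hz⟩⟩
    refine ⟨y, z, ?_⟩
    rintro (r | r)
    · exact (hl y z r).trans (hy r)
    · exact (hr y z r).trans (hz r)

theorem IsPP.forall {K : Type} [Finite K]
    {p : K → ∀ N : C ⥤ AddCommGrpCat.{max u v}, (∀ i, N.obj (σ i)) → Prop}
    (hp : ∀ k, IsPP σ (p k)) : IsPP σ (fun N x => ∀ k, p k N x) := by
  classical
  have := Fintype.ofFinite K
  have h : ∀ s : Finset K, IsPP σ (fun N x => ∀ k ∈ s, p k N x) := by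
    intro s
    induction s using Finset.induction_on with
    | empty => exact IsPP.true.congr fun _ _ _ => by simp
    | insert a s _ ih => exact ((hp a).and ih).congr fun _ _ _ => by simp
  exact (h Finset.univ).congr fun _ _ _ => by simp

/-- The sum of two pp-definable subgroups. -/
theorem IsPP.sup {p q : ∀ N : C ⥤ AddCommGrpCat.{max u v}, (∀ i, N.obj (σ i)) → Prop}
    (hp : IsPP σ p) (hq : IsPP σ q) : IsPP σ (fun N x => ∃ y, p N y ∧ q N (x - y)) :=
  IsPP.exists ((hp.subst fun j => IsLin.coord (σ := Sum.elim σ σ) (Sum.inr j)).and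
    (hq.subst fun j => (IsLin.coord (σ := Sum.elim σ σ) (Sum.inl j)).sub
      (IsLin.coord (σ := Sum.elim σ σ) (Sum.inr j))))

end Calculus

/-! ### Finitely presented modules: definability of the submodules over the endomorphism ring -/

section FinitelyPresented

variable {C : Type u} [Category.{v} C] {M : C ⥤ AddCommGrpCat.{max u v}}

theorem IsEndoNoetherian.isNoetherian_tuples (hM : IsEndoNoetherian M) {ι : Type} [Finite ι]
    (σ : ι → C) : IsNoetherian (End M) (∀ i, M.obj (σ i)) := by
  have : ∀ i, IsNoetherian (End M) (M.obj (σ i)) := fun i => hM (σ i)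
  infer_instance

variable [Preadditive C]

/-- An endomorphism of `M` is determined by the images of finitely many generators, so `End M`
embeds in a finite product of sorts of `M`. -/
theorem IsFinitelyPresented.isNoetherianRing_end (hfp : IsFinitelyPresented M)
    (hM : IsEndoNoetherian M) : IsNoetherianRing (End M) := by
  obtain ⟨n, σ, a, k, ρ, g, hgen, ha, hrel⟩ := hfp
  have := hM.isNoetherian_tuples σ
  refine isNoetherian_of_injective (LinearMap.toSpanSingleton (End M) (∀ i, M.obj (σ i)) a)
    fun s t h => ?_
  have h' : s • a = t • a := h
  refine NatTrans.ext (funext fun c => ?_)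
  ext x
  obtain ⟨f, rfl⟩ := hgen c x
  change s • lin f M a = t • lin f M a
  rw [← lin_tuple_smul, ← lin_tuple_smul, h']

/-- The values of pp-pairs at `M` are finitely presented modules over `End M`. -/
theorem IsFinitelyPresented.finitePresentation_val (hfp : IsFinitelyPresented M)
    (hM : IsEndoNoetherian M) (P : PPPair C) : Module.FinitePresentation (End M) (P.val M) := by
  have := hfp.isNoetherianRing_end hM
  have := hM.isNoetherian_tuples P.σ
  exact Module.finitePresentation_of_finite (End M) (P.val M)

variable [M.Additive]

/-- If the relations between the generators `a i` of `M` are consequences of `g r`, then every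
solution `z` in `M` of these relations is the image of `a` under an endomorphism. -/
theorem exists_end_smul_eq {n : ℕ} {σ : Fin n → C} {a : ∀ i, M.obj (σ i)} {k : ℕ} {ρ : Fin k → C}
    {g : ∀ (r : Fin k) (i : Fin n), σ i ⟶ ρ r}
    (hgen : ∀ (c : C) (x : M.obj c), ∃ f : ∀ i, σ i ⟶ c, lin f M a = x)
    (hrel : ∀ (c : C) (f : ∀ i, σ i ⟶ c), lin f M a = 0 →
      ∃ t : ∀ r, ρ r ⟶ c, ∀ i, f i = ∑ r, g r i ≫ t r)
    (z : ∀ i, M.obj (σ i)) (hz : ∀ r, lin (g r) M z = 0) : ∃ s : End M, s • a = z := by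
  choose F hF using hgen
  have wd : ∀ (c : C) (f f' : ∀ i, σ i ⟶ c), lin f M a = lin f' M a → lin f M z = lin f' M z := by
    intro c f f' h
    obtain ⟨t, ht⟩ := hrel c (fun i => f i + -f' i) (by
      rw [lin_coeff_add, lin_coeff_neg, h, add_neg_cancel])
    have h0 : lin (fun i => f i + -f' i) M z = 0 := by
      rw [funext ht, lin_coeff_sum (fun r i => g r i ≫ t r)]
      refine Finset.sum_eq_zero fun r _ => ?_
      rw [← map_lin, hz, map_zero]
    rw [lin_coeff_add, lin_coeff_neg] at h0
    exact add_neg_eq_zero.mp h0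
  let s : M ⟶ M :=
    { app := fun c => AddCommGrpCat.ofHom (AddMonoidHom.mk' (fun x => lin (F c x) M z) fun x y => by
        rw [← lin_coeff_add]
        exact wd c _ _ (by rw [lin_coeff_add, hF, hF, hF]))
      naturality := fun c d f => by
        ext x
        exact (wd d _ _ (by rw [hF, ← map_lin, hF]; rfl)).trans (map_lin _ f M z).symm }
  refine ⟨s, funext fun i => ?_⟩
  obtain ⟨g, hg⟩ := IsLin.coord.{u, v} (σ := σ) i
  have h : ∀ x, x i = lin g M x := hg M inferInstance
  exact (wd _ _ g (by rw [hF]; exact h a)).trans (h z).symm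

/-- The cyclic submodule generated by a tuple `b` is pp-definable: write `b` as a tuple of linear
forms in the generators `a`; then `End M • b` consists of the values of these forms at the
solutions of the defining relations of `a`. -/
theorem IsFinitelyPresented.exists_sol_eq_span_singleton (hfp : IsFinitelyPresented M) {ι : Type}
    [Fintype ι] {σ : ι → C} (b : ∀ i, M.obj (σ i)) :
    ∃ φ : PPFormula σ, φ.sol M = Submodule.span (End M) {b} := by
  obtain ⟨n, τ, a, k, ρ, g, hgen, ha, hrel⟩ := hfp
  choose f hf using fun i => hgen (σ i) (b i)
  have hp : IsPP.{u, v} σ (fun N x => ∃ z : ∀ j, N.obj (τ j),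
      (∀ r, lin (g r) N z = 0) ∧ ∀ i, x i = lin (f i) N z) :=
    IsPP.exists ((IsPP.forall fun r => IsPP.eq_zero
      (IsLin.lin_comp (g r) fun j => IsLin.coord (σ := Sum.elim σ τ) (Sum.inr j))).and
      (IsPP.forall fun i => IsPP.eq (IsLin.coord (σ := Sum.elim σ τ) (Sum.inl i))
        (IsLin.lin_comp (f i) fun j => IsLin.coord (σ := Sum.elim σ τ) (Sum.inr j))))
  obtain ⟨φ, hφ⟩ := hp
  refine ⟨φ, SetLike.ext fun x => ?_⟩
  rw [hφ M inferInstance, Submodule.mem_span_singleton]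
  constructor
  · rintro ⟨z, hz, hx⟩
    obtain ⟨s, rfl⟩ := exists_end_smul_eq hgen hrel z hz
    refine ⟨s, funext fun i => ?_⟩
    rw [hx i, lin_tuple_smul, hf, Pi.smul_apply]
  · rintro ⟨s, rfl⟩
    refine ⟨s • a, fun r => ?_, fun i => ?_⟩
    · rw [lin_tuple_smul, ha, smul_zero]
    · rw [lin_tuple_smul, hf, Pi.smul_apply]

theorem IsFinitelyPresented.exists_sol_eq (hfp : IsFinitelyPresented M) {ι : Type}
    [Fintype ι] {σ : ι → C} {K : Submodule (End M) (∀ i, M.obj (σ i))} (hK : K.FG) :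
    ∃ φ : PPFormula σ, φ.sol M = K := by
  induction K, hK using Submodule.fg_induction with
  | singleton b => exact hfp.exists_sol_eq_span_singleton b
  | sup K L _ _ hK hL =>
    obtain ⟨φ, rfl⟩ := hK
    obtain ⟨ψ, rfl⟩ := hL
    obtain ⟨χ, hχ⟩ := (IsPP.sol.{u, v} φ).sup (IsPP.sol ψ)
    refine ⟨χ, SetLike.ext fun x => ?_⟩
    rw [hχ M inferInstance, Submodule.mem_sup]
    constructor
    · rintro ⟨y, hy, hz⟩
      exact ⟨y, hy, x - y, hz, add_sub_cancel y x⟩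
    · rintro ⟨y, hy, z, hz, rfl⟩
      exact ⟨y, hy, by rwa [add_sub_cancel_left]⟩

theorem IsFinitelyPresented.exists_sol_eq_of_isEndoNoetherian (hfp : IsFinitelyPresented M)
    (hM : IsEndoNoetherian M) {ι : Type} [Fintype ι] {σ : ι → C}
    (K : Submodule (End M) (∀ i, M.obj (σ i))) : ∃ φ : PPFormula σ, φ.sol M = K :=
  have := hM.isNoetherian_tuples σ
  hfp.exists_sol_eq (IsNoetherian.noetherian K)

end FinitelyPresented

/-! ### Inclusions between pp formulas pass to the generated definable class -/

section Definable

variable {C : Type u} [Category.{v} C] [Preadditive C]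

/-- The additive modules `N` with `φ(N) ≤ ψ(N)`. -/
def solLE {n : ℕ} {σ : Fin n → C} (φ ψ : PPFormula σ) :
    ObjectProperty (C ⥤ AddCommGrpCat.{max u v}) :=
  fun N => N.Additive ∧ φ.sol N ≤ ψ.sol N

theorem solLE_of_iso {n : ℕ} {σ : Fin n → C} {φ ψ : PPFormula σ}
    {N N' : C ⥤ AddCommGrpCat.{max u v}} (e : N ≅ N') (h : solLE φ ψ N) : solLE φ ψ N' := by
  obtain ⟨hN, h⟩ := h
  refine ⟨Functor.additive_of_iso e, fun x hx => ?_⟩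
  have h1 := ψ.map_mem_sol e.hom (h (φ.map_mem_sol e.inv hx))
  convert h1 using 1
  funext i
  exact congrArg (fun (f : N' ⟶ N') => (f.app (σ i)).hom (x i)) e.inv_hom_id.symm

theorem additive_of_isLimit {J : Type w} [Category J] {F : J ⥤ C ⥤ AddCommGrpCat.{max u v}}
    {c : Cone F} (hc : ∀ d, IsLimit (((evaluation C AddCommGrpCat).obj d).mapCone c))
    (hF : ∀ j, (F.obj j).Additive) : c.pt.Additive where
  map_add {X Y f g} := by
    refine (hc Y).hom_ext fun j => ?_
    have := hF j
    have nat : ∀ f : X ⟶ Y, c.pt.map f ≫ (c.π.app j).app Y = (c.π.app j).app X ≫ (F.obj j).map f :=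
      fun f => (c.π.app j).naturality f
    change c.pt.map (f + g) ≫ (c.π.app j).app Y = (c.pt.map f + c.pt.map g) ≫ (c.π.app j).app Y
    rw [Preadditive.add_comp, nat, nat, nat, Functor.map_add, Preadditive.comp_add]

theorem additive_of_isColimit {J : Type w} [Category J] {F : J ⥤ C ⥤ AddCommGrpCat.{max u v}}
    {c : Cocone F} (hc : ∀ d, IsColimit (((evaluation C AddCommGrpCat).obj d).mapCocone c))
    (hF : ∀ j, (F.obj j).Additive) : c.pt.Additive where
  map_add {X Y f g} := by
    refine (hc X).hom_ext fun j => ?_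
    have := hF j
    have nat : ∀ f : X ⟶ Y, (c.ι.app j).app X ≫ c.pt.map f = (F.obj j).map f ≫ (c.ι.app j).app Y :=
      fun f => ((c.ι.app j).naturality f).symm
    change (c.ι.app j).app X ≫ c.pt.map (f + g) = (c.ι.app j).app X ≫ (c.pt.map f + c.pt.map g)
    rw [Preadditive.comp_add, nat, nat, nat, Functor.map_add, Preadditive.add_comp]

theorem solLE_of_isLimit {n : ℕ} {σ : Fin n → C} {φ ψ : PPFormula σ} {J : Type (max u v)}
    {F : Discrete J ⥤ C ⥤ AddCommGrpCat.{max u v}} {c : Cone F} (hc : IsLimit c)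
    (hF : ∀ j, solLE φ ψ (F.obj j)) : solLE φ ψ c.pt := by
  have hc' : ∀ d, IsLimit (((evaluation C AddCommGrpCat).obj d).mapCone c) :=
    fun d => isLimitOfPreserves _ hc
  refine ⟨additive_of_isLimit hc' fun j => (hF j).1, fun x hx => ?_⟩
  have ext : ∀ (d : C) (a b : c.pt.obj d),
      (∀ j, ((c.π.app j).app d).hom a = ((c.π.app j).app d).hom b) → a = b :=
    fun d a b h => Concrete.isLimit_ext _ (hc' d) a b h
  have lift : ∀ (d : C) (a : ∀ j, (F.obj j).obj d),
      ∃ b : c.pt.obj d, ∀ j, ((c.π.app j).app d).hom b = a j := by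
    intro d a
    let e := (Types.isLimitEquivSections (isLimitOfPreserves (forget AddCommGrpCat) (hc' d))).symm
    let s : ((F ⋙ (evaluation C AddCommGrpCat).obj d) ⋙ forget AddCommGrpCat).sections :=
      ⟨fun j => a j, fun {i j} f => by
        obtain ⟨i⟩ := i
        obtain ⟨j⟩ := j
        obtain rfl : i = j := Discrete.eq_of_hom f
        have : f = 𝟙 _ := Subsingleton.elim _ _
        rw [this, CategoryTheory.Functor.map_id]
        rfl⟩
    refine ⟨e s, fun j => ?_⟩
    exact Types.isLimitEquivSections_symm_apply
      (isLimitOfPreserves (forget AddCommGrpCat) (hc' d)) s j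
  have hj := fun j => (hF j).2 (φ.map_mem_sol (c.π.app j) hx)
  -- witnesses for `ψ` in the factors are the components of witnesses in the product
  choose y hy using hj
  choose z hz using fun i => lift (ψ.τ i) (fun j => y j i)
  refine ⟨z, fun r => ext _ _ _ fun j => ?_⟩
  refine (hom_lin_add_lin _ _ (c.π.app j) x z).trans (Eq.trans ?_ (map_zero _).symm)
  rw [← hy j r]
  simp only [hz]

theorem solLE_of_isColimit {n : ℕ} {σ : Fin n → C} {φ ψ : PPFormula σ} {J : Type (max u v)}
    [Preorder J] [IsDirectedOrder J] [Nonempty J]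
    {F : J ⥤ C ⥤ AddCommGrpCat.{max u v}} {c : Cocone F} (hc : IsColimit c)
    (hF : ∀ j, solLE φ ψ (F.obj j)) : solLE φ ψ c.pt := by
  have hc' : ∀ d, IsColimit (((evaluation C AddCommGrpCat).obj d).mapCocone c) :=
    fun d => isColimitOfPreserves _ hc
  refine ⟨additive_of_isColimit hc' fun j => (hF j).1, ?_⟩
  have hmap : ∀ {i j : J} (h : i ≤ j) (d : C) (a : (F.obj i).obj d),
      ((c.ι.app j).app d).hom (((F.map (homOfLE h)).app d).hom a) = ((c.ι.app i).app d).hom a :=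
    fun h d a => congrArg (fun f => (f.app d).hom a) (c.w (homOfLE h))
  -- every finite tuple of elements of the colimit comes from one stage
  have rep : ∀ {m : ℕ} (τ : Fin m → C) (x : ∀ i, c.pt.obj (τ i)),
      ∃ (j : J) (y : ∀ i, (F.obj j).obj (τ i)), ∀ i, ((c.ι.app j).app (τ i)).hom (y i) = x i := by
    intro m τ x
    have h : ∀ i, ∃ (j : J) (y : (F.obj j).obj (τ i)), ((c.ι.app j).app (τ i)).hom y = x i :=
      fun i => Concrete.isColimit_exists_rep _ (hc' (τ i)) (x i)
    choose j y hy using h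
    obtain ⟨k, hk⟩ := Finite.exists_le j
    exact ⟨k, fun i => ((F.map (homOfLE (hk i))).app (τ i)).hom (y i), fun i => by
      rw [hmap, hy]⟩
  have zero : ∀ {d : C} {j : J} (a : (F.obj j).obj d), ((c.ι.app j).app d).hom a = 0 →
      ∃ (k : J) (h : j ≤ k), ((F.map (homOfLE h)).app d).hom a = 0 := by
    intro d j a h
    have h' : ((c.ι.app j).app d).hom a = ((c.ι.app j).app d).hom 0 := h.trans (map_zero _).symm
    obtain ⟨k, f, g, hfg⟩ := Concrete.isColimit_exists_of_rep_eq _ (hc' d) a 0 h'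
    exact ⟨k, leOfHom f, hfg.trans (map_zero ((F.map g).app d).hom)⟩
  rintro x ⟨y, hy⟩
  obtain ⟨j₁, x₁, hx₁⟩ := rep σ x
  obtain ⟨j₂, y₂, hy₂⟩ := rep φ.τ y
  obtain ⟨j, h₁, h₂⟩ := exists_ge_ge j₁ j₂
  let x' : ∀ i, (F.obj j).obj (σ i) := fun i => ((F.map (homOfLE h₁)).app (σ i)).hom (x₁ i)
  let y' : ∀ i, (F.obj j).obj (φ.τ i) := fun i => ((F.map (homOfLE h₂)).app _).hom (y₂ i)
  have hx : (fun i => ((c.ι.app j).app (σ i)).hom (x' i)) = x :=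
    funext fun i => (hmap h₁ _ _).trans (hx₁ i)
  have hy0 : (fun i => ((c.ι.app j).app (φ.τ i)).hom (y' i)) = y :=
    funext fun i => (hmap h₂ _ _).trans (hy₂ i)
  -- the equations of `φ` hold in the colimit, hence each of them holds at some later stage
  have heq : ∀ r, ∃ (k : J) (h : j ≤ k), ((F.map (homOfLE h)).app (φ.ρ r)).hom
      (lin (φ.G r) (F.obj j) x' + lin (φ.H r) (F.obj j) y') = 0 := by
    intro r
    refine zero _ ?_
    refine (hom_lin_add_lin _ _ (c.ι.app j) x' y').trans ?_
    rw [hx, hy0]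
    exact hy r
  choose k hk hk0 using heq
  -- a stage `l` beyond `j` and all the `k r`
  obtain ⟨l, hl⟩ := Finite.exists_le (Option.elim · j k)
  have hjl : j ≤ l := hl none
  have hsol : (fun i => ((F.map (homOfLE hjl)).app (σ i)).hom (x' i)) ∈ φ.sol (F.obj l) := by
    refine ⟨fun i => ((F.map (homOfLE hjl)).app _).hom (y' i), fun r => ?_⟩
    refine (hom_lin_add_lin _ _ (F.map (homOfLE hjl)) x' y').symm.trans ?_
    have e : F.map (homOfLE hjl) = F.map (homOfLE (hk r)) ≫ F.map (homOfLE (hl (some r))) := by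
      rw [← F.map_comp]
      rfl
    rw [e]
    exact (congrArg _ (hk0 r)).trans (map_zero ((F.map (homOfLE (hl (some r)))).app _).hom)
  have e : (fun i => ((c.ι.app l).app (σ i)).hom
      (((F.map (homOfLE hjl)).app (σ i)).hom (x' i))) = x :=
    (funext fun i => hmap hjl _ _).trans hx
  exact (congrArg (· ∈ ψ.sol c.pt) e).mp (ψ.map_mem_sol (c.ι.app l) ((hF l).2 hsol))

theorem isDefinable_solLE {n : ℕ} {σ : Fin n → C} (φ ψ : PPFormula σ) :
    IsDefinable (solLE φ ψ) where
  additive _ h := h.1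
  iso := ⟨fun e h => solLE_of_iso e h⟩
  prod J := ⟨by
    rintro N ⟨h⟩
    exact solLE_of_isLimit h.isLimit h.prop_diag_obj⟩
  directLimit J _ _ _ := ⟨by
    rintro N ⟨h⟩
    exact solLE_of_isColimit h.isColimit h.prop_diag_obj⟩
  pure A B f hA hf hB := ⟨hA, fun x hx =>
    (hf.2 n σ ψ x).2 (hB.2 ((hf.2 n σ φ x).1 hx))⟩

theorem PPPair.subsingleton_val_iff (P : PPPair C) (N : C ⥤ AddCommGrpCat.{max u v}) :
    Subsingleton (P.val N) ↔ P.φ.sol N ≤ P.ψ.sol N := by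
  rw [Submodule.Quotient.subsingleton_iff, Submodule.submoduleOf_eq_top]

/-- A pp-pair that is closed on `M` is closed on the definable class generated by `M`. -/
theorem PPPair.subsingleton_val (P : PPPair C) {M N : C ⥤ AddCommGrpCat.{max u v}}
    (hM : M.Additive) (hN : definableClosure M N) (h : Subsingleton (P.val M)) :
    Subsingleton (P.val N) := by
  rw [P.subsingleton_val_iff] at h ⊢
  exact (hN.2 _ (isDefinable_solLE P.φ P.ψ) ⟨hM, h⟩).2

end Definable

/-! ### Construction of pp-definable functions -/

section Pairs

variable {C : Type u} [Category.{v} C] [Preadditive C]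

/-- The class of `x ∈ φ(N)` in `φ(N)/ψ(N)`. -/
abbrev PPPair.toVal (P : PPPair C) {N : C ⥤ AddCommGrpCat.{max u v}} (x : P.φ.sol N) : P.val N :=
  Submodule.Quotient.mk x

theorem PPPair.toVal_surjective (P : PPPair C) {N : C ⥤ AddCommGrpCat.{max u v}} :
    Function.Surjective (P.toVal (N := N)) :=
  Submodule.Quotient.mk_surjective _

/-- A pp-pair given by two pp-definable conditions. -/
noncomputable def PPPair.ofIsPP {n : ℕ} {σ : Fin n → C}
    {p q : ∀ N : C ⥤ AddCommGrpCat.{max u v}, (∀ i, N.obj (σ i)) → Prop}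
    (hp : IsPP σ p) (hq : IsPP σ q) (h : ∀ N x, q N x → p N x) : PPPair C where
  n := n
  σ := σ
  φ := hp.choose
  ψ := hq.choose
  le N hN x hx := (hp.choose_spec N hN x).2 (h N x ((hq.choose_spec N hN x).1 hx))

section

variable {n : ℕ} {σ : Fin n → C}
  {p q : ∀ N : C ⥤ AddCommGrpCat.{max u v}, (∀ i, N.obj (σ i)) → Prop}
  (hp : IsPP σ p) (hq : IsPP σ q) (h : ∀ N x, q N x → p N x)
  (N : C ⥤ AddCommGrpCat.{max u v}) [hN : N.Additive]

theorem PPPair.mem_φ_ofIsPP (x : ∀ i, N.obj (σ i)) :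
    x ∈ (PPPair.ofIsPP hp hq h).φ.sol N ↔ p N x :=
  hp.choose_spec N hN x

theorem PPPair.mem_ψ_ofIsPP (x : ∀ i, N.obj (σ i)) :
    x ∈ (PPPair.ofIsPP hp hq h).ψ.sol N ↔ q N x :=
  hq.choose_spec N hN x

end

theorem PPFormula.exists_converse {P Q : PPPair C} (θ : PPFormula (Sum.elim P.σ Q.σ)) :
    ∃ θ' : PPFormula (Sum.elim Q.σ P.σ), ∀ N : C ⥤ AddCommGrpCat.{max u v}, N.Additive →
      ∀ (a : P.val N) (b : Q.val N), θ'.rel N b a ↔ θ.rel N a b := by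
  have ht : ∀ j, IsLin.{u, v} (Sum.elim Q.σ P.σ) (fun _ z =>
      pairTuple (σ := P.σ) (σ' := Q.σ) (fun i => z (Sum.inr i)) (fun i => z (Sum.inl i)) j) := by
    rintro (i | i)
    · exact IsLin.coord (σ := Sum.elim Q.σ P.σ) (Sum.inr i)
    · exact IsLin.coord (σ := Sum.elim Q.σ P.σ) (Sum.inl i)
  obtain ⟨θ', h⟩ := (IsPP.sol.{u, v} θ).subst ht
  refine ⟨θ', fun N hN a b => ⟨?_, ?_⟩⟩
  · rintro ⟨y, x, hyx, hy, hx⟩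
    exact ⟨x, y, (h N hN _).1 hyx, hx, hy⟩
  · rintro ⟨x, y, hxy, hx, hy⟩
    exact ⟨y, x, (h N hN (pairTuple y.1 x.1)).2 hxy, hy, hx⟩

end Pairs

namespace PPCat

variable {C : Type u} [Category.{v} C] [Preadditive C] {I : Type*}
  {𝒩 : I → C ⥤ AddCommGrpCat.{max u v}} [∀ i, (𝒩 i).Additive]

/-- The component at `𝒩 i` of a pp-definable function. -/
noncomputable def app {P Q : PPCat 𝒩} (f : P ⟶ Q) (i : I) :
    P.pair.val (𝒩 i) →ₗ[End (𝒩 i)] Q.pair.val (𝒩 i) :=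
  PPCat.Hom.linear f i

@[simp]
theorem app_comp {P Q R : PPCat 𝒩} (f : P ⟶ Q) (g : Q ⟶ R) (i : I) (a : P.pair.val (𝒩 i)) :
    app (f ≫ g) i a = app g i (app f i a) := rfl

theorem hom_ext {P Q : PPCat 𝒩} {f g : P ⟶ Q} (h : ∀ i a, app f i a = app g i a) : f = g :=
  PPCat.Hom.ext (funext fun i => funext fun a => h i a)

theorem exists_rel {P Q : PPCat 𝒩} (f : P ⟶ Q) :
    ∃ θ : PPFormula (Sum.elim P.pair.σ Q.pair.σ), ∀ i a b, app f i a = b ↔ θ.rel (𝒩 i) a b :=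
  PPCat.Hom.definable f

theorem exists_hom_of_rel {P Q : PPCat 𝒩} (θ : PPFormula (Sum.elim P.pair.σ Q.pair.σ))
    (h : ∀ i a, ∃! b, θ.rel (𝒩 i) a b) :
    ∃ f : P ⟶ Q, ∀ i a b, app f i a = b ↔ θ.rel (𝒩 i) a b := by
  choose F hF hF' using h
  have key : ∀ i a b, F i a = b ↔ θ.rel (𝒩 i) a b := fun i a b =>
    ⟨fun e => e ▸ hF i a, fun hb => (hF' i a b hb).symm⟩
  exact ⟨⟨F, θ, key⟩, key⟩

/-- A pp-definable function factors through a pointwise injective one as soon as it does so on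
elements. -/
theorem exists_lift {K P Z : PPCat 𝒩} (f : K ⟶ P) (hf : ∀ i, Function.Injective (app f i))
    (g : Z ⟶ P) (hg : ∀ i a, ∃ k, app f i k = app g i a) : ∃ l : Z ⟶ K, l ≫ f = g := by
  obtain ⟨θf, hθf⟩ := exists_rel f
  obtain ⟨θg, hθg⟩ := exists_rel g
  obtain ⟨θ, hθ⟩ := θf.exists_converse
  have key : ∀ i a k, (compFormula θg θ).rel (𝒩 i) a k ↔ app f i k = app g i a := by
    intro i a k
    rw [rel_compFormula]
    simp only [hθ (𝒩 i) inferInstance, ← hθf, ← hθg]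
    simp
  obtain ⟨l, hl⟩ := exists_hom_of_rel (compFormula θg θ) fun i a => by
    obtain ⟨k, hk⟩ := hg i a
    exact ⟨k, (key i a k).2 hk, fun k' hk' => hf i (((key i a k').1 hk').trans hk.symm)⟩
  exact ⟨l, hom_ext fun i a => (key i a _).1 ((hl i a _).1 rfl)⟩

/-- A pp-definable function factors through a pointwise surjective one as soon as it vanishes on
the kernel of the latter. -/
theorem exists_desc {P L Z : PPCat 𝒩} (f : P ⟶ L) (hf : ∀ i, Function.Surjective (app f i))
    (g : P ⟶ Z) (hg : ∀ i a, app f i a = 0 → app g i a = 0) : ∃ d : L ⟶ Z, f ≫ d = g := by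
  obtain ⟨θf, hθf⟩ := exists_rel f
  obtain ⟨θg, hθg⟩ := exists_rel g
  obtain ⟨θ, hθ⟩ := θf.exists_converse
  have key : ∀ i b c, (compFormula θ θg).rel (𝒩 i) b c ↔ ∃ a, app f i a = b ∧ app g i a = c := by
    intro i b c
    rw [rel_compFormula]
    simp only [hθ (𝒩 i) inferInstance, ← hθf, ← hθg]
  obtain ⟨d, hd⟩ := exists_hom_of_rel (compFormula θ θg) fun i b => by
    obtain ⟨a, rfl⟩ := hf i b
    refine ⟨app g i a, (key i _ _).2 ⟨a, rfl, rfl⟩, fun c hc => ?_⟩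
    obtain ⟨a', ha', rfl⟩ := (key i _ _).1 hc
    have h := hg i (a' - a) (by rw [map_sub, ha', sub_self])
    rwa [map_sub, sub_eq_zero] at h
  exact ⟨d, hom_ext fun i a => (hd i _ _).2 ((key i _ _).2 ⟨a, rfl, rfl⟩)⟩

theorem isIso_of_bijective {P Q : PPCat 𝒩} (f : P ⟶ Q)
    (hf : ∀ i, Function.Bijective (app f i)) : IsIso f := by
  obtain ⟨l, hl⟩ := exists_lift f (fun i => (hf i).1) (𝟙 Q) fun i a => (hf i).2 a
  refine ⟨l, hom_ext fun i a => (hf i).1 ?_, hl⟩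
  exact congrArg (fun g => app g i (app f i a)) hl

/-- Tuples of linear terms define pp-definable functions. -/
theorem exists_hom_of_isLin (P Q : PPCat 𝒩)
    {t : ∀ j, ∀ N : C ⥤ AddCommGrpCat.{max u v}, (∀ i, N.obj (P.pair.σ i)) → N.obj (Q.pair.σ j)}
    (ht : ∀ j, IsLin P.pair.σ (t j))
    (hφ : ∀ i, ∀ x ∈ P.pair.φ.sol (𝒩 i), (fun j => t j (𝒩 i) x) ∈ Q.pair.φ.sol (𝒩 i))
    (hψ : ∀ i, ∀ x ∈ P.pair.ψ.sol (𝒩 i), (fun j => t j (𝒩 i) x) ∈ Q.pair.ψ.sol (𝒩 i)) :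
    ∃ f : P ⟶ Q, ∀ i (x : P.pair.φ.sol (𝒩 i)),
      app f i (P.pair.toVal x) = Q.pair.toVal ⟨fun j => t j (𝒩 i) x.1, hφ i _ x.2⟩ := by
  have hp : IsPP.{u, v} (Sum.elim P.pair.σ Q.pair.σ)
      (fun N z => ∀ j, z (Sum.inr j) = t j N (fun i => z (Sum.inl i))) :=
    IsPP.forall fun j => IsPP.eq (IsLin.coord (σ := Sum.elim P.pair.σ Q.pair.σ) (Sum.inr j))
      ((ht j).subst fun i => IsLin.coord (σ := Sum.elim P.pair.σ Q.pair.σ) (Sum.inl i))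
  obtain ⟨θ, hθ⟩ := hp
  have hθ' : ∀ i (x : P.pair.φ.sol (𝒩 i)) (y : Q.pair.φ.sol (𝒩 i)),
      pairTuple x.1 y.1 ∈ θ.sol (𝒩 i) ↔ y.1 = fun j => t j (𝒩 i) x.1 := fun i x y =>
    (hθ (𝒩 i) inferInstance _).trans funext_iff.symm
  have hsub : ∀ i x x', (fun j => t j (𝒩 i) x) - (fun j => t j (𝒩 i) x') =
      fun j => t j (𝒩 i) (x - x') := by
    intro i x x'
    funext j
    obtain ⟨g, hg⟩ := ht j
    rw [Pi.sub_apply, hg (𝒩 i) inferInstance, hg (𝒩 i) inferInstance, hg (𝒩 i) inferInstance,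
      sub_eq_iff_eq_add, ← lin_tuple_add, sub_add_cancel]
  have key : ∀ i x, θ.rel (𝒩 i) (P.pair.toVal x)
      (Q.pair.toVal ⟨fun j => t j (𝒩 i) x.1, hφ i _ x.2⟩) :=
    fun i x => ⟨x, ⟨_, hφ i _ x.2⟩, (hθ' _ _ _).2 rfl, rfl, rfl⟩
  obtain ⟨f, hf⟩ := exists_hom_of_rel θ fun i a => by
    obtain ⟨x, rfl⟩ := P.pair.toVal_surjective a
    refine ⟨_, key i x, ?_⟩
    rintro b ⟨x', y', h, hx, rfl⟩
    rw [PPPair.mk_eq_mk] at hx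
    rw [PPPair.mk_eq_mk, (hθ' _ _ _).1 h]
    exact (hsub i _ _).symm ▸ hψ i _ hx
  exact ⟨f, fun i x => (hf i _ _).2 (key i x)⟩

/-- The graph of a pp-definable function, as a relation between tuples instead of classes of
tuples, is pp-definable. -/
theorem exists_graph {P Q : PPCat 𝒩} (f : P ⟶ Q) :
    ∃ θ : PPFormula (Sum.elim P.pair.σ Q.pair.σ), ∀ i (x : P.pair.φ.sol (𝒩 i))
      (y : Q.pair.φ.sol (𝒩 i)), pairTuple x.1 y.1 ∈ θ.sol (𝒩 i) ↔
        app f i (P.pair.toVal x) = Q.pair.toVal y := by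
  obtain ⟨θ, hθ⟩ := exists_rel f
  -- `θ` may miss some representatives; adding `ψ × ψ'` to it makes it contain all of them
  have h1 := IsPP.sol.{u, v} θ
  have h2 : IsPP.{u, v} (Sum.elim P.pair.σ Q.pair.σ)
      (fun N z => (fun i => z (Sum.inl i)) ∈ P.pair.ψ.sol N ∧
        (fun i => z (Sum.inr i)) ∈ Q.pair.ψ.sol N) :=
    ((IsPP.sol.{u, v} P.pair.ψ).subst fun i =>
      IsLin.coord (σ := Sum.elim P.pair.σ Q.pair.σ) (Sum.inl i)).and
    ((IsPP.sol.{u, v} Q.pair.ψ).subst fun i =>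
      IsLin.coord (σ := Sum.elim P.pair.σ Q.pair.σ) (Sum.inr i))
  obtain ⟨χ, hχ⟩ := h1.sup h2
  refine ⟨χ, fun i x y => ?_⟩
  rw [hχ (𝒩 i) inferInstance, hθ]
  constructor
  · rintro ⟨z, hz, h, h'⟩
    have hx : (fun j => z (Sum.inl j)) ∈ P.pair.φ.sol (𝒩 i) := by
      have := sub_mem x.2 (P.pair.le (𝒩 i) inferInstance h)
      exact (congrArg (· ∈ P.pair.φ.sol (𝒩 i)) (sub_sub_cancel x.1 _)).mp this
    have hy : (fun j => z (Sum.inr j)) ∈ Q.pair.φ.sol (𝒩 i) := by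
      have := sub_mem y.2 (Q.pair.le (𝒩 i) inferInstance h')
      exact (congrArg (· ∈ Q.pair.φ.sol (𝒩 i)) (sub_sub_cancel y.1 _)).mp this
    refine ⟨⟨_, hx⟩, ⟨_, hy⟩, ?_, ?_, ?_⟩
    · convert hz using 1
      funext j
      rcases j with j | j <;> rfl
    · exact ((PPPair.mk_eq_mk _ _).2 h).symm
    · exact ((PPPair.mk_eq_mk _ _).2 h').symm
  · rintro ⟨x', y', h, hx, hy⟩
    rw [PPPair.mk_eq_mk] at hx hy
    refine ⟨pairTuple x'.1 y'.1, h, ?_, ?_⟩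
    · exact (congrArg (· ∈ P.pair.ψ.sol (𝒩 i)) (neg_sub x'.1 x.1)).mp (neg_mem hx)
    · exact (congrArg (· ∈ Q.pair.ψ.sol (𝒩 i)) (neg_sub y'.1 y.1)).mp (neg_mem hy)

/-- A pp-definable family of subsets of the values of `P` is the image of a subobject of `P`. -/
theorem exists_sub (P : PPCat 𝒩)
    {p : ∀ N : C ⥤ AddCommGrpCat.{max u v}, (∀ i, N.obj (P.pair.σ i)) → Prop}
    (hp : IsPP P.pair.σ p) (S : ∀ i, Set (P.pair.val (𝒩 i)))
    (hS : ∀ i (x : P.pair.φ.sol (𝒩 i)), p (𝒩 i) x.1 ↔ P.pair.toVal x ∈ S i) :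
    ∃ (E : PPCat 𝒩) (f : E ⟶ P), (∀ i, Function.Injective (app f i)) ∧
      ∀ i a, (∃ e, app f i e = a) ↔ a ∈ S i := by
  have h1 := (IsPP.sol.{u, v} P.pair.φ).and hp
  have h2 := h1.and (IsPP.sol.{u, v} P.pair.ψ)
  let E : PPCat 𝒩 := ⟨PPPair.ofIsPP h1 h2 fun _ _ h => h.1⟩
  have hφ : ∀ i x, x ∈ E.pair.φ.sol (𝒩 i) ↔ x ∈ P.pair.φ.sol (𝒩 i) ∧ p (𝒩 i) x :=
    fun i x => PPPair.mem_φ_ofIsPP h1 h2 (fun _ _ h => h.1) (𝒩 i) x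
  have hψ : ∀ i x, x ∈ E.pair.ψ.sol (𝒩 i) ↔
      (x ∈ P.pair.φ.sol (𝒩 i) ∧ p (𝒩 i) x) ∧ x ∈ P.pair.ψ.sol (𝒩 i) :=
    fun i x => PPPair.mem_ψ_ofIsPP h1 h2 (fun _ _ h => h.1) (𝒩 i) x
  obtain ⟨f, hf⟩ := exists_hom_of_isLin E P (t := fun j _ x => x j)
    (fun j => IsLin.coord (σ := P.pair.σ) j) (fun i x hx => ((hφ i x).1 hx).1)
    (fun i x hx => ((hψ i x).1 hx).2)
  refine ⟨E, f, fun i => ?_, fun i a => ⟨?_, fun ha => ?_⟩⟩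
  · rw [injective_iff_map_eq_zero]
    intro a ha
    obtain ⟨x, rfl⟩ := E.pair.toVal_surjective a
    rw [hf, PPPair.mk_eq_zero] at ha
    exact (PPPair.mk_eq_zero _).2 ((hψ i _).2 ⟨(hφ i _).1 x.2, ha⟩)
  · rintro ⟨e, rfl⟩
    obtain ⟨x, rfl⟩ := E.pair.toVal_surjective e
    rw [hf]
    exact (hS i _).1 ((hφ i _).1 x.2).2
  · obtain ⟨x, rfl⟩ := P.pair.toVal_surjective a
    exact ⟨E.pair.toVal ⟨x.1, (hφ i _).2 ⟨x.2, (hS i x).2 ha⟩⟩, hf i _⟩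

/-- A pp-definable family of subsets of the values of `P` is the kernel of a quotient of `P`. -/
theorem exists_quotient (P : PPCat 𝒩)
    {p : ∀ N : C ⥤ AddCommGrpCat.{max u v}, (∀ i, N.obj (P.pair.σ i)) → Prop}
    (hp : IsPP P.pair.σ p) (S : ∀ i, Set (P.pair.val (𝒩 i))) (h0 : ∀ i, 0 ∈ S i)
    (hS : ∀ i (x : P.pair.φ.sol (𝒩 i)), p (𝒩 i) x.1 ↔ P.pair.toVal x ∈ S i) :
    ∃ (L : PPCat 𝒩) (f : P ⟶ L), (∀ i, Function.Surjective (app f i)) ∧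
      ∀ i a, app f i a = 0 ↔ a ∈ S i := by
  have h1 := IsPP.sol.{u, v} P.pair.φ
  have h2 := h1.and hp
  let L : PPCat 𝒩 := ⟨PPPair.ofIsPP h1 h2 fun _ _ h => h.1⟩
  have hφ : ∀ i x, x ∈ L.pair.φ.sol (𝒩 i) ↔ x ∈ P.pair.φ.sol (𝒩 i) :=
    fun i x => PPPair.mem_φ_ofIsPP h1 h2 (fun _ _ h => h.1) (𝒩 i) x
  have hψ : ∀ i x, x ∈ L.pair.ψ.sol (𝒩 i) ↔ x ∈ P.pair.φ.sol (𝒩 i) ∧ p (𝒩 i) x :=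
    fun i x => PPPair.mem_ψ_ofIsPP h1 h2 (fun _ _ h => h.1) (𝒩 i) x
  obtain ⟨f, hf⟩ := exists_hom_of_isLin P L (t := fun j _ x => x j)
    (fun j => IsLin.coord (σ := P.pair.σ) j) (fun i x hx => (hφ i x).2 hx)
    (fun i x hx => by
      have hx' := P.pair.le (𝒩 i) inferInstance hx
      refine (hψ i x).2 ⟨hx', (hS i ⟨x, hx'⟩).2 ?_⟩
      have e : P.pair.toVal ⟨x, hx'⟩ = 0 := (PPPair.mk_eq_zero _).2 hx
      exact (congrArg (· ∈ S i) e).mpr (h0 i))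
  refine ⟨L, f, fun i b => ?_, fun i a => ?_⟩
  · obtain ⟨y, rfl⟩ := L.pair.toVal_surjective b
    exact ⟨P.pair.toVal ⟨y.1, (hφ i _).1 y.2⟩, hf i _⟩
  · obtain ⟨x, rfl⟩ := P.pair.toVal_surjective a
    rw [hf, PPPair.mk_eq_zero, ← hS]
    exact (hψ i _).trans (and_iff_right x.2)

theorem exists_equalizer {P Q : PPCat 𝒩} (f g : P ⟶ Q) :
    ∃ (E : PPCat 𝒩) (e : E ⟶ P), (∀ i, Function.Injective (app e i)) ∧
      ∀ i a, (∃ b, app e i b = a) ↔ app f i a = app g i a := by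
  obtain ⟨θ, hθ⟩ := exists_graph f
  obtain ⟨θ', hθ'⟩ := exists_graph g
  have ht : ∀ j, IsLin.{u, v} (Sum.elim P.pair.σ Q.pair.σ) (fun _ z =>
      pairTuple (σ := P.pair.σ) (σ' := Q.pair.σ)
        (fun i => z (Sum.inl i)) (fun i => z (Sum.inr i)) j) := by
    rintro (i | i)
    · exact IsLin.coord (σ := Sum.elim P.pair.σ Q.pair.σ) (Sum.inl i)
    · exact IsLin.coord (σ := Sum.elim P.pair.σ Q.pair.σ) (Sum.inr i)
  have hp : IsPP.{u, v} P.pair.σ (fun N x => ∃ y, y ∈ Q.pair.φ.sol N ∧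
      pairTuple x y ∈ θ.sol N ∧ pairTuple x y ∈ θ'.sol N) :=
    IsPP.exists (((IsPP.sol.{u, v} Q.pair.φ).subst fun i =>
      IsLin.coord (σ := Sum.elim P.pair.σ Q.pair.σ) (Sum.inr i)).and
        (((IsPP.sol.{u, v} θ).subst ht).and ((IsPP.sol.{u, v} θ').subst ht)))
  refine exists_sub P hp (fun i => {a | app f i a = app g i a}) fun i x => ⟨?_, fun h => ?_⟩
  · rintro ⟨y, hy, h, h'⟩
    exact ((hθ i x ⟨y, hy⟩).1 h).trans ((hθ' i x ⟨y, hy⟩).1 h').symm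
  · obtain ⟨y, hy⟩ := Q.pair.toVal_surjective (app f i (P.pair.toVal x))
    exact ⟨y.1, y.2, (hθ i x y).2 hy.symm, (hθ' i x y).2 (h.symm.trans hy.symm)⟩

theorem exists_kernel {P Q : PPCat 𝒩} (f : P ⟶ Q) :
    ∃ (K : PPCat 𝒩) (k : K ⟶ P), (∀ i, Function.Injective (app k i)) ∧
      ∀ i a, (∃ b, app k i b = a) ↔ app f i a = 0 :=
  exists_equalizer f 0

theorem exists_cokernel {P Q : PPCat 𝒩} (f : P ⟶ Q) :
    ∃ (L : PPCat 𝒩) (π : Q ⟶ L), (∀ i, Function.Surjective (app π i)) ∧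
      ∀ i b, app π i b = 0 ↔ ∃ a, app f i a = b := by
  obtain ⟨θ, hθ⟩ := exists_graph f
  have ht : ∀ j, IsLin.{u, v} (Sum.elim Q.pair.σ P.pair.σ) (fun _ z =>
      pairTuple (σ := P.pair.σ) (σ' := Q.pair.σ)
        (fun i => z (Sum.inr i)) (fun i => z (Sum.inl i)) j) := by
    rintro (i | i)
    · exact IsLin.coord (σ := Sum.elim Q.pair.σ P.pair.σ) (Sum.inr i)
    · exact IsLin.coord (σ := Sum.elim Q.pair.σ P.pair.σ) (Sum.inl i)
  have hp : IsPP.{u, v} Q.pair.σ (fun N y => ∃ x, x ∈ P.pair.φ.sol N ∧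
      pairTuple x y ∈ θ.sol N) :=
    IsPP.exists (((IsPP.sol.{u, v} P.pair.φ).subst fun i =>
      IsLin.coord (σ := Sum.elim Q.pair.σ P.pair.σ) (Sum.inr i)).and
        ((IsPP.sol.{u, v} θ).subst ht))
  refine exists_quotient Q hp (fun i => {b | ∃ a, app f i a = b}) (fun i => ⟨0, map_zero _⟩)
    fun i y => ⟨?_, ?_⟩
  · rintro ⟨x, hx, h⟩
    exact ⟨_, (hθ i ⟨x, hx⟩ y).1 h⟩
  · rintro ⟨a, ha⟩
    obtain ⟨x, rfl⟩ := P.pair.toVal_surjective a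
    exact ⟨x.1, x.2, (hθ i x y).2 ha⟩

end PPCat

/-! ### Fullness up to roofs and essential surjectivity of evaluation -/

section Reindexing

variable {C : Type u} [Category.{v} C] [Preadditive C] {ι : Type} [Fintype ι]

/-- The sorts `σ i`, listed by an initial segment of the natural numbers. -/
noncomputable def listSorts (σ : ι → C) : Fin (Fintype.card ι) → C :=
  fun j => σ ((Fintype.equivFin ι).symm j)

/-- Tuples of sorts `σ i` and of the listed sorts correspond to each other. -/
noncomputable def unlist (σ : ι → C) (N : C ⥤ AddCommGrpCat.{max u v}) :
    (∀ j, N.obj (listSorts σ j)) ≃ₗ[End N] (∀ i, N.obj (σ i)) :=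
  LinearEquiv.piCongrLeft (End N) (fun i => N.obj (σ i)) (Fintype.equivFin ι).symm

theorem isLin_unlist (σ : ι → C) (i : ι) :
    IsLin.{u, v} (listSorts σ) (fun N x => unlist σ N x i) := by
  obtain ⟨j, rfl⟩ := (Fintype.equivFin ι).symm.surjective i
  obtain ⟨g, hg⟩ := IsLin.coord.{u, v} (σ := listSorts σ) j
  refine ⟨g, fun N hN x => ?_⟩
  refine Eq.trans ?_ (hg N hN x)
  exact Equiv.piCongrLeft_apply_apply (fun i => N.obj (σ i)) _ x j

theorem IsPP.unlist {σ : ι → C}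
    {p : ∀ N : C ⥤ AddCommGrpCat.{max u v}, (∀ i, N.obj (σ i)) → Prop} (hp : IsPP σ p) :
    IsPP (listSorts σ) (fun N x => p N (MultisortedModule.unlist σ N x)) :=
  hp.subst fun i => isLin_unlist σ i

end Reindexing

section

variable {C : Type u} [Category.{v} C] [Preadditive C] {I : Type*}
  {𝒩 : I → C ⥤ AddCommGrpCat.{max u v}} [∀ i, (𝒩 i).Additive]

/-- Every homomorphism `h` between values of pp-pairs at `𝒩 i` is, at `𝒩 i`, a fraction of
pp-definable functions: its graph is pp-definable at `𝒩 i`, and the two projections from the graph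
are pp-definable functions. -/
theorem PPCat.exists_roof {i : I} (hfp : IsFinitelyPresented (𝒩 i)) (hM : IsEndoNoetherian (𝒩 i))
    (P Q : PPCat 𝒩) (h : P.pair.val (𝒩 i) →ₗ[End (𝒩 i)] Q.pair.val (𝒩 i)) :
    ∃ (R : PPCat 𝒩) (s : R ⟶ P) (t : R ⟶ Q), Function.Bijective (app s i) ∧
      ∀ r, h (app s i r) = app t i r := by
  let σ : Fin P.pair.n ⊕ Fin Q.pair.n → C := Sum.elim P.pair.σ Q.pair.σ
  let Γ : Submodule (End (𝒩 i)) (∀ j, (𝒩 i).obj (σ j)) :=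
    { carrier := {z | ∃ (x : P.pair.φ.sol (𝒩 i)) (y : Q.pair.φ.sol (𝒩 i)),
        (fun j => z (Sum.inl j)) = x.1 ∧ (fun j => z (Sum.inr j)) = y.1 ∧
          h (P.pair.toVal x) = Q.pair.toVal y}
      zero_mem' := ⟨0, 0, rfl, rfl, map_zero h⟩
      add_mem' := by
        rintro z z' ⟨x, y, hx, hy, e⟩ ⟨x', y', hx', hy', e'⟩
        refine ⟨x + x', y + y', congrArg₂ (· + ·) hx hx', congrArg₂ (· + ·) hy hy', ?_⟩
        exact (map_add h (P.pair.toVal x) (P.pair.toVal x')).trans (congrArg₂ (· + ·) e e')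
      smul_mem' := by
        rintro s z ⟨x, y, hx, hy, e⟩
        refine ⟨s • x, s • y, congrArg (s • ·) hx, congrArg (s • ·) hy, ?_⟩
        exact (map_smul h s (P.pair.toVal x)).trans (congrArg (s • ·) e) }
  obtain ⟨θ, hθ⟩ := hfp.exists_sol_eq_of_isEndoNoetherian hM Γ
  have hmem : ∀ z, z ∈ θ.sol (𝒩 i) ↔ ∃ (x : P.pair.φ.sol (𝒩 i)) (y : Q.pair.φ.sol (𝒩 i)),
      (fun j => z (Sum.inl j)) = x.1 ∧ (fun j => z (Sum.inr j)) = y.1 ∧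
        h (P.pair.toVal x) = Q.pair.toVal y := fun z => by rw [hθ]; rfl
  have hl : ∀ φ : PPFormula P.pair.σ,
      IsPP.{u, v} σ (fun N z => (fun j => z (Sum.inl j)) ∈ φ.sol N) :=
    fun φ => (IsPP.sol.{u, v} φ).subst fun j => IsLin.coord (σ := σ) (Sum.inl j)
  have hr : ∀ φ : PPFormula Q.pair.σ,
      IsPP.{u, v} σ (fun N z => (fun j => z (Sum.inr j)) ∈ φ.sol N) :=
    fun φ => (IsPP.sol.{u, v} φ).subst fun j => IsLin.coord (σ := σ) (Sum.inr j)
  have hp := ((hl P.pair.φ).and ((hr Q.pair.φ).and (IsPP.sol.{u, v} θ))).unlist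
  have hq := hp.and ((hl P.pair.ψ).and (hr Q.pair.ψ)).unlist
  let R : PPCat 𝒩 := ⟨PPPair.ofIsPP hp hq fun _ _ h => h.1⟩
  have hφ := fun k => PPPair.mem_φ_ofIsPP hp hq (fun _ _ h => h.1) (𝒩 k)
  have hψ := fun k => PPPair.mem_ψ_ofIsPP hp hq (fun _ _ h => h.1) (𝒩 k)
  obtain ⟨s, hs⟩ := exists_hom_of_isLin R P
    (t := fun j N x => unlist σ N x (Sum.inl j)) (fun j => isLin_unlist σ (Sum.inl j))
    (fun k x hx => ((hφ k x).1 hx).1) (fun k x hx => ((hψ k x).1 hx).2.1)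
  obtain ⟨t, ht⟩ := exists_hom_of_isLin R Q
    (t := fun j N x => unlist σ N x (Sum.inr j)) (fun j => isLin_unlist σ (Sum.inr j))
    (fun k x hx => ((hφ k x).1 hx).2.1) (fun k x hx => ((hψ k x).1 hx).2.2)
  have key : ∀ r, h (app s i r) = app t i r := by
    intro r
    obtain ⟨z, rfl⟩ := R.pair.toVal_surjective r
    rw [hs, ht]
    obtain ⟨x, y, hx, hy, e⟩ := (hmem _).1 ((hφ i _).1 z.2).2.2
    exact (congrArg (fun x => h (P.pair.toVal x)) (Subtype.ext hx)).trans
      (e.trans (congrArg Q.pair.toVal (Subtype.ext hy)).symm)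
  refine ⟨R, s, t, ⟨?_, fun a => ?_⟩, key⟩
  · rw [injective_iff_map_eq_zero]
    intro r hr0
    have hr1 : app t i r = 0 := by rw [← key, hr0, map_zero]
    obtain ⟨z, rfl⟩ := R.pair.toVal_surjective r
    rw [hs, PPPair.mk_eq_zero] at hr0
    rw [ht, PPPair.mk_eq_zero] at hr1
    exact (PPPair.mk_eq_zero _).2 ((hψ i _).2 ⟨(hφ i _).1 z.2, hr0, hr1⟩)
  · obtain ⟨x, rfl⟩ := P.pair.toVal_surjective a
    obtain ⟨y, hy⟩ := Q.pair.toVal_surjective (h (P.pair.toVal x))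
    obtain ⟨z, hz⟩ := (unlist σ (𝒩 i)).surjective (pairTuple x.1 y.1)
    have hzR : z ∈ R.pair.φ.sol (𝒩 i) := by
      refine (hφ i z).2 ?_
      rw [hz]
      exact ⟨x.2, y.2, (hmem _).2 ⟨x, y, rfl, rfl, hy.symm⟩⟩
    refine ⟨R.pair.toVal ⟨z, hzR⟩, ?_⟩
    rw [hs]
    refine congrArg P.pair.toVal (Subtype.ext ?_)
    exact congrArg (fun w : ∀ j, (𝒩 i).obj (σ j) => fun j => w (Sum.inl j)) hz

end

section EssSurj

variable {C : Type u} [Category.{v} C] [Preadditive C] {M : C ⥤ AddCommGrpCat.{max u v}}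
  [M.Additive]

/-- Every finitely generated module over `End M` is the value of a pp-pair at `M`: the module
`End M` itself is the solution set of the defining relations of the generators of `M`, and the
submodules of its powers are pp-definable. -/
theorem IsFinitelyPresented.exists_val_equiv (hfp : IsFinitelyPresented M)
    (hM : IsEndoNoetherian M) (A : Type w) [AddCommGroup A] [Module (End M) A]
    [Module.Finite (End M) A] : ∃ P : PPPair C, Nonempty (P.val M ≃ₗ[End M] A) := by
  obtain ⟨n, f, hf⟩ := Module.Finite.exists_fin' (End M) A
  obtain ⟨m, τ, a, k, ρ, g, hgen, ha, hrel⟩ := id hfp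
  let σ : Fin n × Fin m → C := fun i => τ i.2
  -- the embedding of the free module in the tuples, `s ↦ (s i • a j)`
  let e : (Fin n → End M) →ₗ[End M] (∀ i, M.obj (σ i)) :=
    { toFun := fun s i => s i.1 • a i.2
      map_add' := fun s t => funext fun i => add_smul (s i.1) (t i.1) (a i.2)
      map_smul' := fun r s => funext fun i => mul_smul r (s i.1) (a i.2) }
  have he : ∀ s t, e s = e t → s = t := by
    intro s t h
    funext i
    refine NatTrans.ext (funext fun c => ?_)
    ext x
    obtain ⟨f, rfl⟩ := hgen c x
    change s i • lin f M a = t i • lin f M a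
    have h' : s i • a = t i • a := funext fun j => congrFun h (i, j)
    rw [← lin_tuple_smul, ← lin_tuple_smul, h']
  have hp : IsPP.{u, v} σ (fun N x => ∀ (i : Fin n) (r : Fin k),
      lin (g r) N (fun j => x (i, j)) = 0) :=
    IsPP.forall fun i => IsPP.forall fun r => IsPP.eq_zero
      (IsLin.lin_comp (g r) fun j => IsLin.coord (σ := σ) (i, j))
  have hrange : ∀ x, (∀ (i : Fin n) (r : Fin k), lin (g r) M (fun j => x (i, j)) = 0) ↔
      ∃ s, e s = x := by
    intro x
    constructor
    · intro h
      choose s hs using fun i => exists_end_smul_eq hgen hrel (fun j => x (i, j)) (h i)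
      exact ⟨s, funext fun i => congrFun (hs i.1) i.2⟩
    · rintro ⟨s, rfl⟩ i r
      exact (lin_tuple_smul (g r) M (s i) a).trans (by rw [ha, smul_zero])
  obtain ⟨θ, hθ⟩ := hfp.exists_sol_eq_of_isEndoNoetherian hM (Submodule.map e (LinearMap.ker f))
  have hq := hp.and (IsPP.sol.{u, v} θ)
  let P : PPPair C := PPPair.ofIsPP hp.unlist hq.unlist fun _ _ h => h.1
  have hφ := PPPair.mem_φ_ofIsPP hp.unlist hq.unlist (fun _ _ h => h.1) M
  have hψ := PPPair.mem_ψ_ofIsPP hp.unlist hq.unlist (fun _ _ h => h.1) M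
  let e' : (Fin n → End M) →ₗ[End M] P.φ.sol M :=
    LinearMap.codRestrict (P.φ.sol M) ((unlist σ M).symm.toLinearMap ∘ₗ e) fun s => by
      refine (hφ _).2 ?_
      have h : unlist σ M ((unlist σ M).symm (e s)) = e s := LinearEquiv.apply_symm_apply _ _
      exact (congrArg (fun x : ∀ i, M.obj (σ i) => ∀ (i : Fin n) (r : Fin k),
        lin (g r) M (fun j => x (i, j)) = 0) h).mpr ((hrange _).2 ⟨s, rfl⟩)
  have he' : ∀ s, unlist σ M (e' s).1 = e s := fun s =>
    LinearEquiv.apply_symm_apply (unlist σ M) (e s)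
  let q : (Fin n → End M) →ₗ[End M] P.val M := Submodule.mkQ _ ∘ₗ e'
  have hqsurj : Function.Surjective q := by
    intro b
    obtain ⟨x, rfl⟩ := P.toVal_surjective b
    obtain ⟨s, hs⟩ := (hrange _).1 ((hφ _).1 x.2)
    refine ⟨s, congrArg P.toVal (Subtype.ext ?_)⟩
    exact (unlist σ M).injective ((he' s).trans hs)
  -- so `P(M)` and `A` are the same quotient of the free module
  have hker : LinearMap.ker q = LinearMap.ker f := by
    ext s
    rw [LinearMap.mem_ker]
    refine (PPPair.mk_eq_zero (e' s)).trans ((hψ _).trans ?_)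
    refine (and_iff_right ((hφ _).1 (e' s).2)).trans ?_
    refine (congrArg (· ∈ θ.sol M) (he' s)).to_iff.trans ?_
    rw [hθ]
    constructor
    · rintro ⟨t, ht, h⟩
      rwa [← he _ _ h]
    · intro h
      exact ⟨s, h, rfl⟩
  exact ⟨P, ⟨(LinearMap.quotKerEquivOfSurjective q hqsurj).symm.trans
    ((Submodule.quotEquivOfEq _ _ hker).trans (LinearMap.quotKerEquivOfSurjective f hf))⟩⟩

end EssSurj

/-! ### A recognition criterion for localisations -/

/-- If `F : A ⥤ B` is essentially surjective, every morphism between objects in its image is a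
fraction of morphisms of `A`, and parallel morphisms with equal images are equalised by a morphism
that `F` inverts, then `F` induces an equivalence from the localisation of `A` at the morphisms that
`F` inverts to `B`. -/
theorem exists_localization_equivalence {A B : Type*} [Category* A] [Category* B] (F : A ⥤ B)
    [F.EssSurj] (W : MorphismProperty A) (hW : ∀ ⦃X Y : A⦄ (f : X ⟶ Y), W f ↔ IsIso (F.map f))
    (hroof : ∀ ⦃X Y : A⦄ (h : F.obj X ⟶ F.obj Y), ∃ (R : A) (s : R ⟶ X) (t : R ⟶ Y),
      IsIso (F.map s) ∧ F.map s ≫ h = F.map t)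
    (heq : ∀ ⦃X Y : A⦄ (f g : X ⟶ Y), F.map f = F.map g →
      ∃ (R : A) (e : R ⟶ X), IsIso (F.map e) ∧ e ≫ f = e ≫ g) :
    ∃ E : W.Localization ≌ B, Nonempty (W.Q ⋙ E.functor ≅ F) := by
  have : W.HasRightCalculusOfFractions :=
    { id_mem := fun X => (hW _).2 (by rw [F.map_id]; infer_instance)
      comp_mem := fun f g hf hg => by
        rw [hW] at hf hg ⊢
        rw [F.map_comp]
        infer_instance
      exists_rightFraction := fun X Y φ => by
        have := (hW _).1 φ.hs
        obtain ⟨R, s, t, hs, hst⟩ := hroof (F.map φ.f ≫ inv (F.map φ.s))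
        obtain ⟨R', e, he, hest⟩ := heq (s ≫ φ.f) (t ≫ φ.s) (by
          rw [F.map_comp, F.map_comp, ← hst, Category.assoc, Category.assoc, IsIso.inv_hom_id,
            Category.comp_id])
        refine ⟨⟨e ≫ s, (hW _).2 ?_, e ≫ t⟩, ?_⟩
        · rw [F.map_comp]
          infer_instance
        · simpa only [Category.assoc] using hest
      ext := fun X Y Y' f g s hs h => by
        have := (hW _).1 hs
        obtain ⟨R, e, he, hfg⟩ := heq f g (by
          rw [← cancel_mono (F.map s), ← F.map_comp, ← F.map_comp, h])
        exact ⟨R, e, (hW _).2 he, hfg⟩ }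
  have hinv : W.IsInvertedBy F := fun X Y f hf => (hW f).1 hf
  let G : W.Localization ⥤ B := Localization.lift F hinv W.Q
  let e : W.Q ⋙ G ≅ F := Localization.fac F hinv W.Q
  have hG : ∀ ⦃X Y : A⦄ (f : X ⟶ Y), G.map (W.Q.map f) = e.hom.app X ≫ F.map f ≫ e.inv.app Y :=
    fun X Y f => by
    rw [← NatTrans.naturality_assoc, Iso.hom_inv_id_app, Category.comp_id]
    rfl
  have hQ : ∀ ⦃X Y : A⦄ (f : X ⟶ Y), IsIso (F.map f) → IsIso (W.Q.map f) :=
    fun X Y f hf => Localization.inverts W.Q W f ((hW f).2 hf)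
  have hess := Localization.essSurj W.Q W
  have hfull : G.Full := G.full_of_comp_essSurj W.Q fun X Y φ => by
    obtain ⟨R, s, t, hs, hst⟩ := hroof (e.inv.app X ≫ φ ≫ e.hom.app Y)
    have := hQ s hs
    refine ⟨inv (W.Q.map s) ≫ W.Q.map t, ?_⟩
    rw [← cancel_epi (G.map (W.Q.map s)), ← G.map_comp, IsIso.hom_inv_id_assoc, hG, hG, ← hst]
    simp
  have hfaithful : G.Faithful := G.faithful_of_comp_essSurj W.Q fun X Y f g hfg => by
    -- `f` and `g` become images of morphisms of `A` after composition with `ψ.s ≫ φ.s`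
    obtain ⟨φ, hφ⟩ := Localization.exists_rightFraction W.Q W f
    obtain ⟨ψ, hψ⟩ := Localization.exists_rightFraction W.Q W (W.Q.map φ.s ≫ g)
    have h1 : W.Q.map (ψ.s ≫ φ.s) ≫ f = W.Q.map (ψ.s ≫ φ.f) := by
      rw [W.Q.map_comp, Category.assoc, hφ, φ.map_s_comp_map, W.Q.map_comp]
    have h2 : W.Q.map (ψ.s ≫ φ.s) ≫ g = W.Q.map ψ.f := by
      rw [W.Q.map_comp, Category.assoc, hψ, ψ.map_s_comp_map]
    have h3 : F.map (ψ.s ≫ φ.f) = F.map ψ.f := by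
      have h : G.map (W.Q.map (ψ.s ≫ φ.f)) = G.map (W.Q.map ψ.f) := by
        rw [← h1, ← h2, G.map_comp, G.map_comp, hfg]
      rw [hG, hG, cancel_epi, cancel_mono] at h
      exact h
    obtain ⟨R, r, hr, hrr⟩ := heq _ _ h3
    have := hQ r hr
    have := Localization.inverts W.Q W _ (W.comp_mem _ _ ψ.hs φ.hs)
    rw [← cancel_epi (W.Q.map (ψ.s ≫ φ.s)), h1, h2, ← cancel_epi (W.Q.map r), ← W.Q.map_comp,
      ← W.Q.map_comp, hrr]
  have hGess : G.EssSurj := ⟨fun b => ⟨W.Q.obj (F.objPreimage b),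
    ⟨e.app _ ≪≫ F.objObjPreimageIso b⟩⟩⟩
  have : G.IsEquivalence := { }
  exact ⟨G.asEquivalence, ⟨e⟩⟩

/-! ### Evaluation at the generating module -/

section Evaluation

variable {C : Type u} [Category.{v} C] [Preadditive C] {I : Type*}
  {𝒩 : I → C ⥤ AddCommGrpCat.{max u v}} [∀ i, (𝒩 i).Additive]

namespace PPCat

theorem subsingleton_val_of_comp_eq_zero {K P Q : PPCat 𝒩} {k : K ⟶ P} {f : P ⟶ Q} {i : I}
    (hk : Function.Injective (app k i)) (hkf : ∀ b, app f i (app k i b) = 0)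
    (hf : Function.Injective (app f i)) : Subsingleton (K.pair.val (𝒩 i)) :=
  ⟨fun b b' => hk (hf ((hkf b).trans (hkf b').symm))⟩

theorem subsingleton_val_of_surjective {P Q L : PPCat 𝒩} {f : P ⟶ Q} {π : Q ⟶ L} {i : I}
    (hπ : Function.Surjective (app π i)) (hfπ : ∀ a, app π i (app f i a) = 0)
    (hf : Function.Surjective (app f i)) : Subsingleton (L.pair.val (𝒩 i)) := by
  refine subsingleton_of_forall_eq 0 fun c => ?_
  obtain ⟨b, rfl⟩ := hπ c
  obtain ⟨a, rfl⟩ := hf b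
  exact hfπ a

/-- The kernel and the cokernel of `f` are pp-pairs; if they are closed on a module, then they are
closed on the definable class that it generates. -/
theorem bijective_app_of_definableClosure {P Q : PPCat 𝒩} (f : P ⟶ Q) {i j : I}
    (hj : definableClosure (𝒩 i) (𝒩 j)) (hf : Function.Bijective (app f i)) :
    Function.Bijective (app f j) := by
  obtain ⟨K, k, hk, hkf⟩ := exists_kernel f
  obtain ⟨L, π, hπ, hfπ⟩ := exists_cokernel f
  have hK := K.pair.subsingleton_val inferInstance hj
    (subsingleton_val_of_comp_eq_zero (hk i) (fun b => (hkf i _).1 ⟨b, rfl⟩) hf.1)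
  have hL := L.pair.subsingleton_val inferInstance hj
    (subsingleton_val_of_surjective (hπ i) (fun a => (hfπ i _).2 ⟨a, rfl⟩) hf.2)
  refine ⟨(injective_iff_map_eq_zero _).2 fun a ha => ?_, fun b => ?_⟩
  · obtain ⟨b, rfl⟩ := (hkf j a).2 ha
    rw [Subsingleton.elim b 0, map_zero]
  · exact (hfπ j b).1 (Subsingleton.elim _ _)

end PPCat

/-- Evaluation at a finitely presented endonoetherian module, as a functor to the category of
finitely presented modules over the endomorphism ring. -/
noncomputable abbrev evalFP {i : I} (hfp : IsFinitelyPresented (𝒩 i))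
    (hM : IsEndoNoetherian (𝒩 i)) : PPCat 𝒩 ⥤ FPModuleCat (End (𝒩 i)) :=
  ObjectProperty.lift _ (evalAt 𝒩 i) fun P => hfp.finitePresentation_val hM P.pair

section

variable {i : I} (hfp : IsFinitelyPresented (𝒩 i)) (hM : IsEndoNoetherian (𝒩 i))

theorem isIso_evalFP_map_iff {P Q : PPCat 𝒩} (f : P ⟶ Q) :
    IsIso ((evalFP hfp hM).map f) ↔ Function.Bijective (PPCat.app f i) := by
  rw [← ObjectProperty.isIso_hom_iff]
  exact ConcreteCategory.isIso_iff_bijective ((evalAt 𝒩 i).map f)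

theorem evalFP_map_eq_iff {P Q : PPCat 𝒩} (f g : P ⟶ Q) :
    (evalFP hfp hM).map f = (evalFP hfp hM).map g ↔ ∀ a, PPCat.app f i a = PPCat.app g i a := by
  constructor
  · intro h a
    exact congrArg (fun k => k.hom.hom a) h
  · intro h
    refine ObjectProperty.hom_ext _ (ModuleCat.hom_ext (LinearMap.ext h))

theorem essSurj_evalFP : (evalFP hfp hM).EssSurj where
  mem_essImage A := by
    have : Module.FinitePresentation (End (𝒩 i)) A.obj := A.property
    obtain ⟨P, ⟨e⟩⟩ := hfp.exists_val_equiv hM A.obj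
    exact ⟨⟨P⟩, ⟨ObjectProperty.isoMk _ e.toModuleIso⟩⟩

theorem evalFP_exists_roof {P Q : PPCat 𝒩}
    (h : (evalFP hfp hM).obj P ⟶ (evalFP hfp hM).obj Q) :
    ∃ (R : PPCat 𝒩) (s : R ⟶ P) (t : R ⟶ Q), IsIso ((evalFP hfp hM).map s) ∧
      (evalFP hfp hM).map s ≫ h = (evalFP hfp hM).map t := by
  obtain ⟨R, s, t, hs, hst⟩ := PPCat.exists_roof hfp hM P Q h.hom.hom
  refine ⟨R, s, t, (isIso_evalFP_map_iff hfp hM s).2 hs, ?_⟩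
  exact ObjectProperty.hom_ext _ (ModuleCat.hom_ext (LinearMap.ext hst))

theorem evalFP_exists_equalizer {P Q : PPCat 𝒩} (f g : P ⟶ Q)
    (h : (evalFP hfp hM).map f = (evalFP hfp hM).map g) :
    ∃ (E : PPCat 𝒩) (e : E ⟶ P), IsIso ((evalFP hfp hM).map e) ∧ e ≫ f = e ≫ g := by
  rw [evalFP_map_eq_iff] at h
  obtain ⟨E, e, he, hfg⟩ := PPCat.exists_equalizer f g
  exact ⟨E, e, (isIso_evalFP_map_iff hfp hM e).2 ⟨he i, fun a => (hfg i a).2 (h a)⟩,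
    PPCat.hom_ext fun j b => (hfg j _).1 ⟨b, rfl⟩⟩

end

/-- If all the modules `𝒩 j` belong to the definable class generated by `𝒩 i`, then evaluation at
`𝒩 i` is an equivalence, since it reflects isomorphisms. -/
theorem exists_equivalence_of_definableClosure {i : I} (hfp : IsFinitelyPresented (𝒩 i))
    (hM : IsEndoNoetherian (𝒩 i)) (hD : ∀ j, definableClosure (𝒩 i) (𝒩 j)) :
    ∃ E : PPCat 𝒩 ≌ FPModuleCat (End (𝒩 i)),
      Nonempty (E.functor ⋙ FPModuleCat.incl (End (𝒩 i)) ≅ evalAt 𝒩 i) := by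
  have hiso : ∀ {P Q : PPCat 𝒩} (f : P ⟶ Q), IsIso ((evalFP hfp hM).map f) → IsIso f :=
    fun f hf => PPCat.isIso_of_bijective f fun j =>
      PPCat.bijective_app_of_definableClosure f (hD j) ((isIso_evalFP_map_iff hfp hM f).1 hf)
  have := essSurj_evalFP hfp hM
  have : (evalFP hfp hM).Full := ⟨fun {P Q} h => by
    obtain ⟨R, s, t, hs, hst⟩ := evalFP_exists_roof hfp hM h
    have := hiso s hs
    exact ⟨inv s ≫ t, by rw [Functor.map_comp, Functor.map_inv, ← hst, IsIso.inv_hom_id_assoc]⟩⟩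
  have : (evalFP hfp hM).Faithful := ⟨fun {P Q f g} h => by
    obtain ⟨E, e, he, hfg⟩ := evalFP_exists_equalizer hfp hM f g h
    have := hiso e he
    rwa [cancel_epi] at hfg⟩
  have : (evalFP hfp hM).IsEquivalence := { }
  exact ⟨(evalFP hfp hM).asEquivalence, ⟨Iso.refl _⟩⟩

end Evaluation

section Localization

variable {C : Type u} [Category.{v} C] [Preadditive C] {M : C ⥤ AddCommGrpCat.{max u v}}

/-- The morphisms inverted in the functor category of the definable class generated by `M` are
those which are bijective at `M`. -/
theorem isoModulo_closedOn_definableClosure_iff (hM : M.Additive) {P Q : PPCat (allModules C)}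
    (f : P ⟶ Q) : isoModulo (closedOn (definableClosure M)) f ↔
      Function.Bijective (PPCat.app f ⟨M, hM⟩) := by
  obtain ⟨K₀, k, hk, hkf⟩ := PPCat.exists_kernel f
  obtain ⟨L₀, q, hq, hfq⟩ := PPCat.exists_cokernel f
  have hkf0 : k ≫ f = 0 := PPCat.hom_ext fun j b => (hkf j _).1 ⟨b, rfl⟩
  have hfq0 : f ≫ q = 0 := PPCat.hom_ext fun j a => (hfq j _).2 ⟨a, rfl⟩
  constructor
  · rintro ⟨⟨K, ι, w, ⟨hι⟩, hK⟩, ⟨L, π, w', ⟨hπ⟩, hL⟩⟩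
    have := hK M ⟨hM, fun _ _ h => h⟩
    have := hL M ⟨hM, fun _ _ h => h⟩
    obtain ⟨l, hl⟩ := KernelFork.IsLimit.lift' hι k hkf0
    obtain ⟨d, hd⟩ := CokernelCofork.IsColimit.desc' hπ q hfq0
    have hl' : l ≫ ι = k := hl
    have hd' : π ≫ d = q := hd
    refine ⟨(injective_iff_map_eq_zero _).2 fun a ha => ?_, fun b => (hfq _ b).1 ?_⟩
    · obtain ⟨b, rfl⟩ := (hkf _ a).2 ha
      rw [← hl', PPCat.app_comp,
        Subsingleton.elim (α := K.pair.val M) (PPCat.app l ⟨M, hM⟩ b) 0, map_zero]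
    · rw [← hd', PPCat.app_comp,
        Subsingleton.elim (α := L.pair.val M) (PPCat.app π ⟨M, hM⟩ b) 0, map_zero]
  · intro hf
    refine ⟨⟨K₀, k, hkf0, ⟨?_⟩, fun D hD => ?_⟩, ⟨L₀, q, hfq0, ⟨?_⟩, fun D hD => ?_⟩⟩
    · have h : ∀ {Z : PPCat (allModules C)} (g : Z ⟶ P), g ≫ f = 0 → ∃ l : Z ⟶ K₀, l ≫ k = g :=
        fun g hg => PPCat.exists_lift k hk g fun j a => (hkf j _).2
          (congrArg (fun m => PPCat.app m j a) hg)
      exact KernelFork.IsLimit.ofι k hkf0 (fun g hg => (h g hg).choose)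
        (fun g hg => (h g hg).choose_spec) fun g hg m hm => PPCat.hom_ext fun j a => hk j
          (congrArg (fun m => PPCat.app m j a) (hm.trans (h g hg).choose_spec.symm))
    · exact K₀.pair.subsingleton_val hM hD (PPCat.subsingleton_val_of_comp_eq_zero (hk ⟨M, hM⟩)
        (fun b => (hkf _ _).1 ⟨b, rfl⟩) hf.1)
    · have h : ∀ {Z : PPCat (allModules C)} (g : Q ⟶ Z), f ≫ g = 0 → ∃ d : L₀ ⟶ Z, q ≫ d = g :=
        fun g hg => PPCat.exists_desc q hq g fun j b hb => by
          obtain ⟨a, rfl⟩ := (hfq j b).1 hb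
          exact congrArg (fun m => PPCat.app m j a) hg
      exact CokernelCofork.IsColimit.ofπ q hfq0 (fun g hg => (h g hg).choose)
        (fun g hg => (h g hg).choose_spec) fun g hg m hm => PPCat.hom_ext fun j c => by
          obtain ⟨b, rfl⟩ := hq j c
          exact congrArg (fun m => PPCat.app m j b) (hm.trans (h g hg).choose_spec.symm)
    · exact L₀.pair.subsingleton_val hM hD (PPCat.subsingleton_val_of_surjective (hq ⟨M, hM⟩)
        (fun a => (hfq _ _).2 ⟨a, rfl⟩) hf.2)

theorem exists_functorCategory_equivalence (hM : M.Additive) (hfp : IsFinitelyPresented M)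
    (hnoeth : IsEndoNoetherian M) :
    ∃ E : FunctorCategory (definableClosure M) ≌ FPModuleCat (End M),
      Nonempty (quotientFunctor (definableClosure M) ⋙ E.functor ⋙ FPModuleCat.incl (End M) ≅
        evalAt (allModules C) ⟨M, hM⟩) := by
  let F : PPCat (allModules C) ⥤ FPModuleCat (End M) :=
    evalFP (𝒩 := allModules C) (i := ⟨M, hM⟩) hfp hnoeth
  have : F.EssSurj := essSurj_evalFP (𝒩 := allModules C) (i := ⟨M, hM⟩) hfp hnoeth
  obtain ⟨E, ⟨e⟩⟩ := exists_localization_equivalence F (isoModulo (closedOn (definableClosure M)))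
    (fun P Q f => (isoModulo_closedOn_definableClosure_iff hM f).trans
      (isIso_evalFP_map_iff (𝒩 := allModules C) (i := ⟨M, hM⟩) hfp hnoeth f).symm)
    (fun P Q h => evalFP_exists_roof (𝒩 := allModules C) (i := ⟨M, hM⟩) hfp hnoeth h)
    (fun P Q f g h => evalFP_exists_equalizer (𝒩 := allModules C) (i := ⟨M, hM⟩) hfp hnoeth f g h)
  exact ⟨E, ⟨Functor.isoWhiskerRight e (FPModuleCat.incl (End M))⟩⟩

end Localization

end MultisortedModule

open MultisortedModule
theorem theorem10p1 {C : Type u} [Category.{v} C] [Preadditive C]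
    (M : C ⥤ AddCommGrpCat.{max u v}) [hM : M.Additive]
    (hfp : IsFinitelyPresented M) (hnoeth : IsEndoNoetherian M) :
    -- the functor category of the definable subcategory generated by `M`
    (∃ E : FunctorCategory (definableClosure M) ≌ FPModuleCat (End M),
      Nonempty (quotientFunctor (definableClosure M) ⋙ E.functor ⋙ FPModuleCat.incl (End M) ≅
        evalAt (allModules C) ⟨M, hM⟩)) ∧
    -- the category of pp-pairs for the definable subcategory generated by `M`
    (∃ E : PPCat (modulesIn (definableClosure M)) ≌ FPModuleCat (End M),
      Nonempty (E.functor ⋙ FPModuleCat.incl (End M) ≅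
        evalAt (modulesIn (definableClosure M)) ⟨M, hM, fun _ _ h => h⟩)) ∧
    -- the category of pp-pairs for `M`
    (∃ E : PPCat (fun _ : Unit => M) ≌ FPModuleCat (End M),
      Nonempty (E.functor ⋙ FPModuleCat.incl (End M) ≅ evalAt (fun _ : Unit => M) ())) := by
  refine ⟨exists_functorCategory_equivalence hM hfp hnoeth, ?_, ?_⟩
  · exact exists_equivalence_of_definableClosure (𝒩 := modulesIn (definableClosure M))
      (i := ⟨M, hM, fun _ _ h => h⟩) hfp hnoeth fun N => N.2
  · exact exists_equivalence_of_definableClosure (𝒩 := fun _ : Unit => M) (i := ()) hfp hnoeth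
      fun _ => ⟨hM, fun _ _ h => h⟩
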